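/- An evader $E$ and two pursuers $P_1,P_2$ move in the field $\Omega=\{(x,y): 0\le x\le\bar x,\ y\ge 0\}$, $\bar x>0$, with constant speeds $0<v_E<v_1<v_2$; each player chooses its heading, i.e. $\dot x=v\cos u$, $\dot y=v\sin u$ with $u$ measurable with values in $[-\pi,\pi]$, and stays in $\Omega$. The goal line is $\{(x,0):0\le x\le\bar x\}$. The evader wants to be on the goal line before any pursuer is at its position (capture), and the pursuers want to capture it before it is on the goal line. Both teams use non-anticipative strategies, the evader with some positive delay; a team *wins* from a state if it has a strategy that achieves its aim against all controls of the other team. Let $\mathbf x=(x_E,y_E,x_1,y_1,x_2,y_2)$ be a state with all three players in $\Omega$, put $\gamma_1=v_E/v_1$, $\gamma_2=v_E/v_2$, $\gamma=v_1/v_2$ (all $<1$), and suppose that $P_1$ can reach the left corner $(0,0)$ no later than $P_2$, and $P_2$ can reach the right corner $(\bar x,0)$ no later than $P_1$. The Apollonius circle of a player at $(a,b)$ and a player at $(a',b')$ with speed ratio $c<1$ has centre $\frac{1}{1-c^2}(a-c^2a',\,b-c^2b')$ and radius $\frac{c}{1-c^2}\sqrt{(a-a')^2+(b-b')^2}$;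 the $EP_1$, $EP_2$ and $P_1P_2$ circles have ratios $\gamma_1,\gamma_2,\gamma$. Let $$x_I=\frac{x_1-\gamma^2x_2+\sqrt{\gamma^2(x_1-x_2)^2-(1-\gamma^2)(y_1^2-\gamma^2y_2^2)}}{1-\gamma^2}.$$ The radicand is non-negative, $x_I\in[0,\bar x]$, and $(x_I,0)$ is the rightmost point of the $P_1P_2$ Apollonius circle on the $x$-axis. The numbers $$\tau_1=\gamma_1^2x_1,\quad \tau_2=(1-\gamma_1^2)x_I+\gamma_1^2x_1,\quad \tau_3=(1-\gamma_2^2)x_I+\gamma_2^2x_2,\quad \tau_4=(1-\gamma_2^2)\bar x+\gamma_2^2x_2$$ satisfy $\tau_1\le\tau_2\le\tau_3\le\tau_4$. Define the Barrier function by $$B(\mathbf x)=\begin{cases}B_1=\gamma_1^2(x_1^2+y_1^2)-x_E^2-y_E^2 & x_E\le\tau_1\\ B_2=\gamma_1^2\big(x_1^2+(1-\gamma_1^2)y_1^2\big)+\gamma_1^2x_E^2-(1-\gamma_1^2)y_E^2-2\gamma_1^2x_1x_E & \tau_1<x_E\le\tau_2\\ B_3=\gamma_1^2\big((x_1-x_I)^2+y_1^2\big)-(x_E-x_I)^2-y_E^2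 & \tau_2<x_E\le\tau_3\\ B_4=\gamma_2^2\big(x_2^2+(1-\gamma_2^2)y_2^2\big)+\gamma_2^2x_E^2-(1-\gamma_2^2)y_E^2-2\gamma_2^2x_2x_E & \tau_3<x_E\le\tau_4\\ B_5=\gamma_2^2\big((x_2-\bar x)^2+y_2^2\big)-(x_E-\bar x)^2-y_E^2 & x_E>\tau_4.\end{cases}$$ Then the evader wins from $\mathbf x$ if and only if $B(\mathbf x)>0$, the pursuers win if and only if $B(\mathbf x)<0$, and neither side wins if and only if $B(\mathbf x)=0$ (the Barrier surface). In the five cases, $B(\mathbf x)=0$ if and only if, respectively: (1) the $EP_1$ circle passes through the corner $(0,0)$; (2) the $EP_1$ circle is tangent to the $x$-axis at a point of the goal line; (3) the $EP_1$ and the $EP_2$ circle both pass through $(x_I,0)$; (4) the $EP_2$ circle is tangent to the $x$-axis at a point of the goal line; (5) the $EP_2$ circle passes through the corner $(\bar x,0)$. Let $B(\mathbf x)=0$, and let $g$ be, in the five cases, $0$, the abscissa of the centre of the $EP_1$ circle, $x_I$, the abscissa of the centre of the $EP_2$ circle, $\bar x$. Then $g\in[0,\bar x]$; the evader has a strategy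 that brings it to $(g,0)$ without being captured earlier; and the pursuers have a strategy that captures the evader, such that the evader is not on the goal line before the capture and, if it is on the goal line at the moment of capture, then it is at $(g,0)$ and is captured there by $P_1$ in cases (1), (2), by both pursuers simultaneously in case (3), and by $P_2$ in cases (4), (5). -/

import Mathlib

noncomputable section

namespace Football

/-- The data of the game: the field is `[0, xbar] × [0, ∞)`, and `vE`, `v1`, `v2` are the speeds
of the evader `E` and of the pursuers `P₁`, `P₂`. -/
structure Game where
  xbar : ℝ
  vE : ℝ
  v1 : ℝ
  v2 : ℝ

/-- A state of the game: the positions of `E`, `P₁`, `P₂` in the plane. -/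
structure State where
  E : ℝ × ℝ
  P1 : ℝ × ℝ
  P2 : ℝ × ℝ

/-! ### The differential game -/

/-- The field `Ω`. -/
def field (G : Game) : Set (ℝ × ℝ) :=
  {p | 0 ≤ p.1 ∧ p.1 ≤ G.xbar ∧ 0 ≤ p.2}

/-- The goal line: the part of the field with `y = 0`. -/
def goalLine (G : Game) : Set (ℝ × ℝ) :=
  {p | p ∈ field G ∧ p.2 = 0}

/-- The position at time `t` of a player who starts at `p`, has speed `v` and uses the heading
`u s` at time `s`: the solution of `x' = v cos u`, `y' = v sin u`. -/
def position (v : ℝ) (p : ℝ × ℝ) (u : ℝ → ℝ) (t : ℝ) : ℝ × ℝ :=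
  (p.1 + ∫ s in (0 : ℝ)..t, v * Real.cos (u s), p.2 + ∫ s in (0 : ℝ)..t, v * Real.sin (u s))

/-- The admissible controls of a player who starts at `p` with speed `v`: measurable headings
with values in `[-π, π]` that keep the player in the field. -/
structure Admissible (G : Game) (v : ℝ) (p : ℝ × ℝ) (u : ℝ → ℝ) : Prop where
  measurable : Measurable u
  mem_Icc : ∀ t, u t ∈ Set.Icc (-Real.pi) Real.pi
  mem_field : ∀ t, 0 ≤ t → position v p u t ∈ field G

/-- Two controls coincide (almost everywhere) during the time interval `[0, t]`. -/
def AgreeUpTo (t : ℝ) (u u' : ℝ → ℝ) : Prop :=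
  ∀ᵐ s ∂(MeasureTheory.volume.restrict (Set.Icc 0 t)), u s = u' s

/-- A non-anticipative strategy of the pursuer team: a map from the evader's admissible controls
to pairs of admissible controls of the pursuers, whose values during `[0, t]` depend only on the
evader's control during `[0, t]`. -/
structure PursuerStrategy (G : Game) (x : State) (β : (ℝ → ℝ) → (ℝ → ℝ) × (ℝ → ℝ)) : Prop where
  admissible : ∀ φ, Admissible G G.vE x.E φ →
    Admissible G G.v1 x.P1 (β φ).1 ∧ Admissible G G.v2 x.P2 (β φ).2
  nonanticipative : ∀ φ φ', Admissible G G.vE x.E φ → Admissible G G.vE x.E φ' →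
    ∀ t, AgreeUpTo t φ φ' → AgreeUpTo t (β φ).1 (β φ').1 ∧ AgreeUpTo t (β φ).2 (β φ').2

/-- A non-anticipative strategy of the evader with a positive delay `τ`: a map from pairs of
admissible controls of the pursuers to admissible controls of the evader, whose values during
`[0, t + τ]` depend only on the pursuers' controls during `[0, t]`. -/
structure EvaderStrategy (G : Game) (x : State) (α : (ℝ → ℝ) → (ℝ → ℝ) → (ℝ → ℝ)) : Prop where
  admissible : ∀ ψ₁ ψ₂, Admissible G G.v1 x.P1 ψ₁ → Admissible G G.v2 x.P2 ψ₂ →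
    Admissible G G.vE x.E (α ψ₁ ψ₂)
  delay : ∃ τ : ℝ, 0 < τ ∧ ∀ ψ₁ ψ₂ ψ₁' ψ₂',
    Admissible G G.v1 x.P1 ψ₁ → Admissible G G.v2 x.P2 ψ₂ →
    Admissible G G.v1 x.P1 ψ₁' → Admissible G G.v2 x.P2 ψ₂' →
    ∀ t, AgreeUpTo t ψ₁ ψ₁' → AgreeUpTo t ψ₂ ψ₂' →
      AgreeUpTo (t + τ) (α ψ₁ ψ₂) (α ψ₁' ψ₂')

/-- `P₁` is at the position of the evader at time `t`. -/
def CapturedBy1 (G : Game) (x : State) (φ ψ₁ : ℝ → ℝ) (t : ℝ) : Prop :=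
  position G.v1 x.P1 ψ₁ t = position G.vE x.E φ t

/-- `P₂` is at the position of the evader at time `t`. -/
def CapturedBy2 (G : Game) (x : State) (φ ψ₂ : ℝ → ℝ) (t : ℝ) : Prop :=
  position G.v2 x.P2 ψ₂ t = position G.vE x.E φ t

/-- Some pursuer is at the position of the evader at time `t`. -/
def Captured (G : Game) (x : State) (φ ψ₁ ψ₂ : ℝ → ℝ) (t : ℝ) : Prop :=
  CapturedBy1 G x φ ψ₁ t ∨ CapturedBy2 G x φ ψ₂ t

/-- The evader has a strategy that brings it to the goal line before it is captured, whatever the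
pursuers do. -/
def EvaderWins (G : Game) (x : State) : Prop :=
  ∃ α, EvaderStrategy G x α ∧ ∀ ψ₁ ψ₂, Admissible G G.v1 x.P1 ψ₁ → Admissible G G.v2 x.P2 ψ₂ →
    ∃ T, 0 ≤ T ∧ position G.vE x.E (α ψ₁ ψ₂) T ∈ goalLine G ∧
      ∀ t, 0 ≤ t → t ≤ T → ¬ Captured G x (α ψ₁ ψ₂) ψ₁ ψ₂ t

/-- The pursuers have a strategy that captures the evader before it is at the goal line, whatever
the evader does. -/
def PursuersWin (G : Game) (x : State) : Prop :=
  ∃ β, PursuerStrategy G x β ∧ ∀ φ, Admissible G G.vE x.E φ →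
    ∃ T, 0 ≤ T ∧ Captured G x φ (β φ).1 (β φ).2 T ∧
      ∀ t, 0 ≤ t → t ≤ T → position G.vE x.E φ t ∉ goalLine G

/-- The evader has a strategy that brings it to the point `(g, 0)`, whatever the pursuers do, and
is not captured earlier. -/
def EvaderSecures (G : Game) (x : State) (g : ℝ) : Prop :=
  ∃ α, EvaderStrategy G x α ∧ ∀ ψ₁ ψ₂, Admissible G G.v1 x.P1 ψ₁ → Admissible G G.v2 x.P2 ψ₂ →
    ∃ T, 0 ≤ T ∧ position G.vE x.E (α ψ₁ ψ₂) T = (g, 0) ∧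
      ∀ t, 0 ≤ t → t < T → ¬ Captured G x (α ψ₁ ψ₂) ψ₁ ψ₂ t

/-- The pursuers have a strategy that captures the evader, whatever it does, and such that the
evader is not at the goal line earlier; if it is there at the time of capture, then at the
point `(g, 0)`, and it is captured there by `P₁` if `act1` holds and by `P₂` if `act2` holds (by
both simultaneously if both hold). -/
def PursuersSecure (G : Game) (x : State) (g : ℝ) (act1 act2 : Prop) : Prop :=
  ∃ β, PursuerStrategy G x β ∧ ∀ φ, Admissible G G.vE x.E φ →
    ∃ T, 0 ≤ T ∧ Captured G x φ (β φ).1 (β φ).2 T ∧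
      (∀ t, 0 ≤ t → t < T → position G.vE x.E φ t ∉ goalLine G) ∧
      (position G.vE x.E φ T ∈ goalLine G →
        position G.vE x.E φ T = (g, 0) ∧
        (act1 → CapturedBy1 G x φ (β φ).1 T) ∧ (act2 → CapturedBy2 G x φ (β φ).2 T))

/-! ### Apollonius circles -/

/-- The time that a player with speed `v` needs from `p` to `q`. -/
def travelTime (v : ℝ) (p q : ℝ × ℝ) : ℝ :=
  √((p.1 - q.1) ^ 2 + (p.2 - q.2) ^ 2) / v

/-- The abscissa of the centre of the Apollonius circle of a player at `A` and a player at `B`,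
`c < 1` being the speed of the former divided by the speed of the latter. -/
def apolloniusAbscissa (c : ℝ) (A B : ℝ × ℝ) : ℝ := 1 / (1 - c ^ 2) * (A.1 - c ^ 2 * B.1)

/-- The ordinate of the centre. -/
def apolloniusOrdinate (c : ℝ) (A B : ℝ × ℝ) : ℝ := 1 / (1 - c ^ 2) * (A.2 - c ^ 2 * B.2)

/-- The radius. -/
def apolloniusRadius (c : ℝ) (A B : ℝ × ℝ) : ℝ :=
  c / (1 - c ^ 2) * √((A.1 - B.1) ^ 2 + (A.2 - B.2) ^ 2)

/-- The Apollonius circle. -/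
def apolloniusCircle (c : ℝ) (A B : ℝ × ℝ) : Set (ℝ × ℝ) :=
  {p | (p.1 - apolloniusAbscissa c A B) ^ 2 + (p.2 - apolloniusOrdinate c A B) ^ 2 =
    apolloniusRadius c A B ^ 2}

/-- The set `C` (a circle) touches the `x`-axis in a single point, which is on the goal line. -/
def TangentToGoalLine (G : Game) (C : Set (ℝ × ℝ)) : Prop :=
  ∃ p ∈ goalLine G, C ∩ {q | q.2 = 0} = {p}

/-! ### The Barrier function -/

/-- The speed ratio `γ₁`. -/
def γ₁ (G : Game) : ℝ := G.vE / G.v1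

/-- The speed ratio `γ₂`. -/
def γ₂ (G : Game) : ℝ := G.vE / G.v2

/-- The speed ratio `γ` of the pursuers. -/
def γ (G : Game) : ℝ := G.v1 / G.v2

/-- The radicand in the formula for `x_I`. -/
def radicand (G : Game) (x : State) : ℝ :=
  γ G ^ 2 * (x.P1.1 - x.P2.1) ^ 2 - (1 - γ G ^ 2) * (x.P1.2 ^ 2 - γ G ^ 2 * x.P2.2 ^ 2)

/-- The number `x_I`. -/
def xI (G : Game) (x : State) : ℝ :=
  (x.P1.1 - γ G ^ 2 * x.P2.1 + √(radicand G x)) / (1 - γ G ^ 2)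

def B₁ (G : Game) (x : State) : ℝ :=
  γ₁ G ^ 2 * (x.P1.1 ^ 2 + x.P1.2 ^ 2) - x.E.1 ^ 2 - x.E.2 ^ 2

def B₂ (G : Game) (x : State) : ℝ :=
  γ₁ G ^ 2 * (x.P1.1 ^ 2 + (1 - γ₁ G ^ 2) * x.P1.2 ^ 2) + γ₁ G ^ 2 * x.E.1 ^ 2
    - (1 - γ₁ G ^ 2) * x.E.2 ^ 2 - 2 * γ₁ G ^ 2 * x.P1.1 * x.E.1

def B₃ (G : Game) (x : State) : ℝ :=
  γ₁ G ^ 2 * ((x.P1.1 - xI G x) ^ 2 + x.P1.2 ^ 2) - (x.E.1 - xI G x) ^ 2 - x.E.2 ^ 2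

def B₄ (G : Game) (x : State) : ℝ :=
  γ₂ G ^ 2 * (x.P2.1 ^ 2 + (1 - γ₂ G ^ 2) * x.P2.2 ^ 2) + γ₂ G ^ 2 * x.E.1 ^ 2
    - (1 - γ₂ G ^ 2) * x.E.2 ^ 2 - 2 * γ₂ G ^ 2 * x.P2.1 * x.E.1

def B₅ (G : Game) (x : State) : ℝ :=
  γ₂ G ^ 2 * ((x.P2.1 - G.xbar) ^ 2 + x.P2.2 ^ 2) - (x.E.1 - G.xbar) ^ 2 - x.E.2 ^ 2

/-- The threshold between the first and the second piece. -/
def τ₁ (G : Game) (x : State) : ℝ := γ₁ G ^ 2 * x.P1.1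

/-- The threshold between the second and the third piece. -/
def τ₂ (G : Game) (x : State) : ℝ := (1 - γ₁ G ^ 2) * xI G x + γ₁ G ^ 2 * x.P1.1

/-- The threshold between the third and the fourth piece. -/
def τ₃ (G : Game) (x : State) : ℝ := (1 - γ₂ G ^ 2) * xI G x + γ₂ G ^ 2 * x.P2.1

/-- The threshold between the fourth and the fifth piece. -/
def τ₄ (G : Game) (x : State) : ℝ := (1 - γ₂ G ^ 2) * G.xbar + γ₂ G ^ 2 * x.P2.1

/-- A function that is given by five pieces, according to the position of `x_E` relative to the
four thresholds. -/
def pieces (G : Game) (x : State) (b₁ b₂ b₃ b₄ b₅ : ℝ) : ℝ :=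
  if x.E.1 ≤ τ₁ G x then b₁
  else if x.E.1 ≤ τ₂ G x then b₂
  else if x.E.1 ≤ τ₃ G x then b₃
  else if x.E.1 ≤ τ₄ G x then b₄
  else b₅

/-- The Barrier function. -/
def barrier (G : Game) (x : State) : ℝ :=
  pieces G x (B₁ G x) (B₂ G x) (B₃ G x) (B₄ G x) (B₅ G x)

/-- The abscissa of the goal line point that corresponds to each piece: the left corner, the
abscissa of the centre of the `EP₁` circle, `x_I`, the abscissa of the centre of the `EP₂` circle,
the right corner. -/
def aimPoint (G : Game) (x : State) : ℝ :=
  pieces G x 0 (apolloniusAbscissa (γ₁ G) x.E x.P1) (xI G x)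
    (apolloniusAbscissa (γ₂ G) x.E x.P2) G.xbar

end Football

end

noncomputable section

namespace Football

open MeasureTheory Filter Topology

/-! ### Integrals of bounded measurable functions -/

theorem intervalIntegrable_of_abs_le {c : ℝ → ℝ} {M : ℝ} (hm : Measurable c)
    (hb : ∀ s, |c s| ≤ M) (a b : ℝ) : IntervalIntegrable c volume a b :=
  (intervalIntegrable_const (c := M)).mono_fun hm.aestronglyMeasurable
    (Eventually.of_forall fun s => by
      simpa using (hb s).trans (le_abs_self M))

/-- The triangle inequality for the integral of a plane vector. -/
theorem sq_integral_add_sq_integral_le {α β f : ℝ → ℝ} {t : ℝ} (ht : 0 ≤ t)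
    (hα : IntervalIntegrable α volume 0 t) (hβ : IntervalIntegrable β volume 0 t)
    (hf : IntervalIntegrable f volume 0 t) (hf0 : ∀ s, 0 ≤ f s)
    (h : ∀ s, α s ^ 2 + β s ^ 2 ≤ f s ^ 2) :
    (∫ s in (0 : ℝ)..t, α s) ^ 2 + (∫ s in (0 : ℝ)..t, β s) ^ 2
      ≤ (∫ s in (0 : ℝ)..t, f s) ^ 2 := by
  set A := ∫ s in (0 : ℝ)..t, α s with hA
  set B := ∫ s in (0 : ℝ)..t, β s with hB
  set R := √(A ^ 2 + B ^ 2) with hR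
  have hRR : R ^ 2 = A ^ 2 + B ^ 2 := Real.sq_sqrt (by positivity)
  have hR0 : 0 ≤ R := Real.sqrt_nonneg _
  have key : A * A + B * B ≤ R * ∫ s in (0 : ℝ)..t, f s := by
    have e1 : A * A + B * B = ∫ s in (0 : ℝ)..t, (A * α s + B * β s) := by
      rw [intervalIntegral.integral_add (hα.const_mul A) (hβ.const_mul B),
        intervalIntegral.integral_const_mul, intervalIntegral.integral_const_mul]
    rw [e1, ← intervalIntegral.integral_const_mul]
    refine intervalIntegral.integral_mono_on ht ((hα.const_mul A).add (hβ.const_mul B))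
      (hf.const_mul R) fun s _ => ?_
    refine abs_le_of_sq_le_sq' ?_ (mul_nonneg hR0 (hf0 s)) |>.2
    rw [mul_pow, hRR]
    nlinarith [sq_nonneg (A * β s - B * α s),
      mul_le_mul_of_nonneg_left (h s) (by positivity : 0 ≤ A ^ 2 + B ^ 2)]
  have hI : 0 ≤ ∫ s in (0 : ℝ)..t, f s := intervalIntegral.integral_nonneg ht fun s _ => hf0 s
  rw [← hRR]
  rcases hR0.eq_or_lt with h0 | h0
  · rw [← h0, zero_pow two_ne_zero]; exact sq_nonneg _
  · have : R ≤ ∫ s in (0 : ℝ)..t, f s := by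
      refine le_of_mul_le_mul_left ?_ h0
      nlinarith
    gcongr

/-! ### Foldings of the line -/

/-- A folding of the line: near every point it is an isometry or an isometry of the distance to
that point. -/
structure IsFold (w : ℝ → ℝ) : Prop where
  lipschitz : LipschitzWith 1 w
  local_form : ∀ x, HasDerivAt w 1 x ∨ HasDerivAt w (-1) x ∨
    ∃ s : ℝ, (s = 1 ∨ s = -1) ∧ ∀ᶠ y in 𝓝 x, w y = w x + s * |y - x|

/-- The sign of the derivative of a folding. -/
def foldSign (w : ℝ → ℝ) (x : ℝ) : ℝ := if deriv w x = -1 then -1 else 1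

theorem foldSign_sq (w : ℝ → ℝ) (x : ℝ) : foldSign w x ^ 2 = 1 := by
  unfold foldSign; split_ifs <;> norm_num

theorem measurable_foldSign (w : ℝ → ℝ) : Measurable (foldSign w) :=
  Measurable.ite (measurable_deriv w (measurableSet_singleton _)) measurable_const
    measurable_const

theorem IsFold.deriv_comp {w : ℝ → ℝ} (hw : IsFold w) {X : ℝ → ℝ} {c s : ℝ}
    (hX : HasDerivAt X c s) (hd : DifferentiableAt ℝ (fun t => w (X t)) s) :
    deriv (fun t => w (X t)) s = foldSign w (X s) * c := by
  rcases hw.local_form (X s) with h | h | ⟨σ, hσ, h⟩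
  · have := (h.comp s hX).deriv
    simp only [Function.comp_def] at this
    rw [this, foldSign, h.deriv]; norm_num
  · have := (h.comp s hX).deriv
    simp only [Function.comp_def] at this
    rw [this, foldSign, h.deriv]; norm_num
  · have hev : ∀ᶠ t in 𝓝 s, w (X t) = w (X s) + σ * |X t - X s| :=
      hX.continuousAt.eventually h
    have hd0 : deriv (fun t => w (X t)) s = 0 := by
      rcases hσ with rfl | rfl
      · refine IsLocalMin.deriv_eq_zero ?_
        filter_upwards [hev] with t ht
        rw [ht]; linarith [abs_nonneg (X t - X s)]
      · refine IsLocalMax.deriv_eq_zero ?_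
        filter_upwards [hev] with t ht
        rw [ht]; linarith [abs_nonneg (X t - X s)]
    have hX0 : HasDerivAt X 0 s := by
      have h1 := hd.hasDerivAt
      rw [hd0, hasDerivAt_iff_isLittleO] at h1
      rw [hasDerivAt_iff_isLittleO]
      refine Asymptotics.IsLittleO.congr' (f₁ := fun t => |X t - X s|) ?_ ?_ EventuallyEq.rfl
        |> Asymptotics.isLittleO_norm_left.1
      · refine (h1.const_mul_left σ).congr' ?_ EventuallyEq.rfl
        filter_upwards [hev] with t ht
        rcases hσ with rfl | rfl <;> simp [ht]
      · filter_upwards with t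
        simp
    rw [hd0, hX.unique hX0, mul_zero]

theorem IsFold.integral {w : ℝ → ℝ} (hw : IsFold w) {c : ℝ → ℝ} {M : ℝ} (hm : Measurable c)
    (hb : ∀ s, |c s| ≤ M) (p t : ℝ) :
    w p + ∫ s in (0 : ℝ)..t, foldSign w (p + ∫ r in (0 : ℝ)..s, c r) * c s
      = w (p + ∫ r in (0 : ℝ)..t, c r) := by
  have hi := intervalIntegrable_of_abs_le hm hb
  have hM : 0 ≤ M := (abs_nonneg _).trans (hb 0)
  set X : ℝ → ℝ := fun s => p + ∫ r in (0 : ℝ)..s, c r with hX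
  have hXl : LipschitzWith M.toNNReal X := by
    refine LipschitzWith.of_dist_le_mul fun a b => ?_
    rw [Real.dist_eq, Real.dist_eq, Real.coe_toNNReal _ hM]
    have : X a - X b = ∫ r in b..a, c r := by
      simp only [hX, add_sub_add_left_eq_sub]
      exact intervalIntegral.integral_interval_sub_left (hi 0 a) (hi 0 b)
    rw [this]
    exact intervalIntegral.norm_integral_le_of_norm_le_const
      fun r _ => (Real.norm_eq_abs _).trans_le (hb r)
  have hZ : LipschitzWith (1 * M.toNNReal) (fun s => w (X s)) := hw.lipschitz.comp hXl
  have hloc : LocallyIntegrable c volume := by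
    intro s
    refine ⟨Set.Ioc (s - 1) (s + 1), Ioc_mem_nhds (by linarith) (by linarith), ?_⟩
    exact (intervalIntegrable_iff_integrableOn_Ioc_of_le (by linarith)).1 (hi (s - 1) (s + 1))
  have hae : ∀ᵐ s, deriv (fun s => w (X s)) s = foldSign w (X s) * c s := by
    filter_upwards [LocallyIntegrable.ae_hasDerivAt_integral hloc,
      hZ.ae_differentiableAt_of_real] with s h1 h2
    exact hw.deriv_comp ((h1 0).const_add p) h2
  have hftc := (hZ.lipschitzOnWith (s := Set.uIcc 0 t)).absolutelyContinuousOnInterval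
    |>.integral_deriv_eq_sub
  have h2 : ∫ s in (0 : ℝ)..t, foldSign w (X s) * c s
      = ∫ s in (0 : ℝ)..t, deriv (fun s => w (X s)) s :=
    intervalIntegral.integral_congr_ae (by filter_upwards [hae] with s hs _ using hs.symm)
  rw [h2, hftc]
  simp [hX]

theorem isFold_abs : IsFold (fun x => |x|) where
  lipschitz := by
    refine LipschitzWith.of_dist_le_mul fun a b => ?_
    simpa [Real.dist_eq] using abs_abs_sub_abs_le_abs_sub a b
  local_form x := by
    rcases lt_trichotomy x 0 with h | h | h
    · exact Or.inr (Or.inl (hasDerivAt_abs_neg h))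
    · subst h
      exact Or.inr (Or.inr ⟨1, Or.inl rfl, by simp⟩)
    · exact Or.inl (hasDerivAt_abs_pos h)

/-- The folding of the line onto `[0, L]`. -/
def triangleWave (L x : ℝ) : ℝ := ‖(x : AddCircle (2 * L))‖

theorem triangleWave_eq_abs {L x : ℝ} (hL : 0 < L) (hx : |x| ≤ L) : triangleWave L x = |x| := by
  rw [triangleWave, AddCircle.norm_coe_eq_abs_iff _ (by positivity),
    abs_of_pos (by positivity : 0 < 2 * L)]
  linarith

theorem triangleWave_add_int {L : ℝ} (x : ℝ) (k : ℤ) :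
    triangleWave L (x + k * (2 * L)) = triangleWave L x := by
  have : ((k * (2 * L) : ℝ) : AddCircle (2 * L)) = 0 :=
    (AddCircle.coe_eq_zero_iff _).2 ⟨k, by simp⟩
  rw [triangleWave, AddCircle.coe_add, this, add_zero, triangleWave]

theorem triangleWave_mem_Icc {L : ℝ} (hL : 0 < L) (x : ℝ) :
    triangleWave L x ∈ Set.Icc 0 L := by
  refine ⟨norm_nonneg _, (AddCircle.norm_le_half_period _ (by positivity)).trans ?_⟩
  rw [abs_of_pos (by positivity)]; linarith

theorem isFold_triangleWave {L : ℝ} (hL : 0 < L) : IsFold (triangleWave L) where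
  lipschitz := by
    refine LipschitzWith.of_dist_le_mul fun a b => ?_
    rw [Real.dist_eq, NNReal.coe_one, one_mul, dist_eq_norm]
    refine (abs_norm_sub_norm_le _ _).trans ?_
    rw [← AddCircle.coe_sub]
    exact QuotientAddGroup.norm_mk_le_norm
  local_form x := by
    set k := round ((2 * L)⁻¹ * x) with hk
    set z := x - k * (2 * L) with hz
    have hzL : |z| ≤ L := by
      have := triangleWave_mem_Icc hL x
      rw [triangleWave, AddCircle.norm_eq] at this
      exact this.2
    have hper : ∀ (j : ℤ) y, triangleWave L y = triangleWave L (y - j * (2 * L)) := fun j y => by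
      rw [← triangleWave_add_int (y - j * (2 * L)) j, sub_add_cancel]
    have hnear : ∀ (j : ℤ), |x - j * (2 * L)| < L →
        ∀ᶠ y in 𝓝 x, triangleWave L y = |y - j * (2 * L)| := fun j hj => by
      have : ContinuousAt (fun y => |y - j * (2 * L)|) x := by fun_prop
      filter_upwards [this.eventually_lt_const hj] with y hy
      rw [hper j, triangleWave_eq_abs hL hy.le]
    rcases hzL.lt_or_eq with hlt | heq
    · have h := hnear k hlt
      have hd : HasDerivAt (fun y : ℝ => y - k * (2 * L)) 1 x :=
        (hasDerivAt_id x).sub_const _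
      rcases lt_trichotomy z 0 with h0 | h0 | h0
      · right; left
        refine HasDerivAt.congr_of_eventuallyEq ?_ h
        simpa [Function.comp_def] using (hasDerivAt_abs_neg h0).comp x hd
      · right; right
        refine ⟨1, Or.inl rfl, ?_⟩
        filter_upwards [h] with y hy
        have hx : x = k * (2 * L) := by linarith
        rw [hy, hper k x, ← hz, h0, triangleWave_eq_abs hL (by simpa using hL.le)]
        simp [hx]
      · left
        refine HasDerivAt.congr_of_eventuallyEq ?_ h
        simpa [Function.comp_def] using (hasDerivAt_abs_pos h0).comp x hd
    · right; right
      refine ⟨-1, Or.inr rfl, ?_⟩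
      obtain ⟨j, hj⟩ : ∃ j : ℤ, x - j * (2 * L) = L := by
        rcases abs_eq hL.le |>.1 heq with h | h
        · exact ⟨k, h⟩
        · exact ⟨k - 1, by push_cast; linarith⟩
      have hball : ∀ᶠ y in 𝓝 x, |y - x| < L := by
        have : ContinuousAt (fun y => |y - x|) x := by fun_prop
        exact this.eventually_lt_const (by simpa using hL)
      have hxL : triangleWave L x = L := by
        rw [hper j, hj, triangleWave_eq_abs hL (abs_of_pos hL).le, abs_of_pos hL]
      filter_upwards [hball] with y hy
      rw [hxL]
      rcases abs_lt.1 hy with ⟨h1, h2⟩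
      rcases le_total y x with h | h
      · rw [hper j, triangleWave_eq_abs hL (by rw [abs_le]; constructor <;> linarith),
          abs_of_nonneg (by linarith), abs_of_nonpos (by linarith)]
        linarith
      · rw [hper (j + 1)]
        push_cast
        rw [triangleWave_eq_abs hL (by rw [abs_le]; constructor <;> linarith),
          abs_of_nonpos (by linarith), abs_of_nonneg (by linarith)]
        linarith

/-! ### Controls and positions -/

theorem intervalIntegrable_speed_cos {u : ℝ → ℝ} (hu : Measurable u) (v a b : ℝ) :
    IntervalIntegrable (fun s => v * Real.cos (u s)) volume a b :=
  intervalIntegrable_of_abs_le (M := |v|) (by fun_prop) (fun s => by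
    rw [abs_mul]; exact mul_le_of_le_one_right (abs_nonneg _) (Real.abs_cos_le_one _)) a b

theorem intervalIntegrable_speed_sin {u : ℝ → ℝ} (hu : Measurable u) (v a b : ℝ) :
    IntervalIntegrable (fun s => v * Real.sin (u s)) volume a b :=
  intervalIntegrable_of_abs_le (M := |v|) (by fun_prop) (fun s => by
    rw [abs_mul]; exact mul_le_of_le_one_right (abs_nonneg _) (Real.abs_sin_le_one _)) a b

theorem sq_dist_position_le {v t : ℝ} {u : ℝ → ℝ} (hv : 0 ≤ v) (ht : 0 ≤ t) (hu : Measurable u)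
    (p : ℝ × ℝ) :
    ((position v p u t).1 - p.1) ^ 2 + ((position v p u t).2 - p.2) ^ 2 ≤ (v * t) ^ 2 := by
  have := sq_integral_add_sq_integral_le ht (intervalIntegrable_speed_cos hu v 0 t)
    (intervalIntegrable_speed_sin hu v 0 t) (intervalIntegrable_const (c := v)) (fun _ => hv)
    (fun s => by rw [mul_pow, mul_pow, ← mul_add, Real.cos_sq_add_sin_sq, mul_one])
  simpa [position, mul_comm] using this

theorem AgreeUpTo.mono {s t : ℝ} {u u' : ℝ → ℝ} (h : AgreeUpTo t u u') (hst : s ≤ t) :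
    AgreeUpTo s u u' :=
  ae_mono (Measure.restrict_mono (Set.Icc_subset_Icc_right hst) le_rfl) h

theorem AgreeUpTo.integral_comp {t : ℝ} {u u' : ℝ → ℝ} (h : AgreeUpTo t u u') (ht : 0 ≤ t)
    (f : ℝ → ℝ) : ∫ s in (0 : ℝ)..t, f (u s) = ∫ s in (0 : ℝ)..t, f (u' s) := by
  refine intervalIntegral.integral_congr_ae ?_
  filter_upwards [(ae_restrict_iff' measurableSet_Icc).1 h] with s hs hmem
  rw [Set.uIoc_of_le ht] at hmem
  rw [hs (Set.Ioc_subset_Icc_self hmem)]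

theorem AgreeUpTo.position_eq {t : ℝ} {u u' : ℝ → ℝ} (h : AgreeUpTo t u u') (ht : 0 ≤ t)
    (v : ℝ) (p : ℝ × ℝ) : position v p u t = position v p u' t := by
  unfold position
  rw [h.integral_comp ht (fun θ => v * Real.cos θ), h.integral_comp ht (fun θ => v * Real.sin θ)]

/-- The heading of the vector `(a, b)`. -/
def heading (a b : ℝ) : ℝ := Complex.arg ⟨a, b⟩

theorem heading_mem_Icc (a b : ℝ) : heading a b ∈ Set.Icc (-Real.pi) Real.pi :=
  ⟨(Complex.neg_pi_lt_arg _).le, Complex.arg_le_pi _⟩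

theorem norm_of_sq_add_sq_eq_one {a b : ℝ} (h : a ^ 2 + b ^ 2 = 1) : ‖(⟨a, b⟩ : ℂ)‖ = 1 := by
  rw [Complex.norm_def, Complex.normSq_mk, ← pow_two, ← pow_two, h, Real.sqrt_one]

theorem cos_heading {a b : ℝ} (h : a ^ 2 + b ^ 2 = 1) : Real.cos (heading a b) = a := by
  have := Complex.norm_mul_cos_arg ⟨a, b⟩
  rwa [norm_of_sq_add_sq_eq_one h, one_mul] at this

theorem sin_heading {a b : ℝ} (h : a ^ 2 + b ^ 2 = 1) : Real.sin (heading a b) = b := by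
  have := Complex.norm_mul_sin_arg ⟨a, b⟩
  rwa [norm_of_sq_add_sq_eq_one h, one_mul] at this

theorem measurable_heading {f g : ℝ → ℝ} (hf : Measurable f) (hg : Measurable g) :
    Measurable fun s => heading (f s) (g s) := by
  have : Measurable fun s => (f s : ℂ) + (g s : ℂ) * Complex.I := by fun_prop
  simpa only [heading, Complex.mk_eq_add_mul_I, Function.comp_def] using
    Complex.measurable_arg.comp this

/-! ### The straight run of the evader -/

/-- The evader runs straight to `(g, 0)`, where it arrives at time `T`. -/
theorem exists_straight_run {G : Game} {v : ℝ} (hv : 0 < v) {p : ℝ × ℝ} (hp : p ∈ field G)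
    {g : ℝ} (hg : g ∈ Set.Icc 0 G.xbar) :
    ∃ φ T, Admissible G v p φ ∧ 0 ≤ T ∧ (p.1 - g) ^ 2 + p.2 ^ 2 = (v * T) ^ 2 ∧
      ∀ t, 0 ≤ t → t ≤ T → ((position v p φ t).1 - g) ^ 2 + (position v p φ t).2 ^ 2
        = (v * (T - t)) ^ 2 := by
  set z : ℂ := ⟨g - p.1, -p.2⟩ with hz
  set θ := Complex.arg z
  set T := ‖z‖ / v with hT
  have hT0 : 0 ≤ T := by positivity
  have hvT : v * T = ‖z‖ := by rw [hT]; field_simp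
  have hc : v * T * Real.cos θ = g - p.1 := by rw [hvT]; exact Complex.norm_mul_cos_arg z
  have hs : v * T * Real.sin θ = -p.2 := by rw [hvT]; exact Complex.norm_mul_sin_arg z
  set φ : ℝ → ℝ := fun t => if t ≤ T then θ else Real.pi / 2 with hφ
  have hm : Measurable φ := Measurable.ite measurableSet_Iic measurable_const measurable_const
  have hbefore : ∀ (f : ℝ → ℝ) t, 0 ≤ t → t ≤ T →
      ∫ s in (0 : ℝ)..t, f (φ s) = t * f θ := fun f t h0 h1 => by
    rw [intervalIntegral.integral_congr_ae (g := fun _ => f θ)]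
    · simp
    · refine Eventually.of_forall fun s hs => ?_
      rw [Set.uIoc_of_le h0] at hs
      simp [hφ, hs.2.trans h1]
  have hafter : ∀ (f : ℝ → ℝ) t, T ≤ t →
      ∫ s in T..t, f (φ s) = (t - T) * f (Real.pi / 2) := fun f t h0 => by
    rw [intervalIntegral.integral_congr_ae (g := fun _ => f (Real.pi / 2))]
    · simp
    · refine Eventually.of_forall fun s hs => ?_
      rw [Set.uIoc_of_le h0] at hs
      simp [hφ, not_le.2 hs.1]
  have hpos : ∀ t, 0 ≤ t → t ≤ T →
      position v p φ t = (p.1 + t * (v * Real.cos θ), p.2 + t * (v * Real.sin θ)) :=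
    fun t h0 h1 => by
      unfold position
      rw [hbefore (fun a => v * Real.cos a) t h0 h1, hbefore (fun a => v * Real.sin a) t h0 h1]
  have hpos' : ∀ t, T ≤ t → position v p φ t = (g, v * (t - T)) := fun t h0 => by
    unfold position
    rw [← intervalIntegral.integral_add_adjacent_intervals
        (intervalIntegrable_speed_cos hm v 0 T) (intervalIntegrable_speed_cos hm v T t),
      ← intervalIntegral.integral_add_adjacent_intervals
        (intervalIntegrable_speed_sin hm v 0 T) (intervalIntegrable_speed_sin hm v T t),
      hbefore (fun a => v * Real.cos a) T hT0 le_rfl,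
      hbefore (fun a => v * Real.sin a) T hT0 le_rfl,
      hafter (fun a => v * Real.cos a) t h0, hafter (fun a => v * Real.sin a) t h0,
      Real.cos_pi_div_two, Real.sin_pi_div_two]
    ext <;> simp only <;> linarith
  refine ⟨φ, T, ⟨hm, fun t => ?_, fun t ht => ?_⟩, hT0, ?_, fun t h0 h1 => ?_⟩
  · simp only [hφ]
    split_ifs
    · exact heading_mem_Icc _ _
    · constructor <;> linarith [Real.pi_pos]
  · rcases le_total t T with h | h
    · rw [hpos t ht h]
      obtain ⟨a1, a2, a3⟩ := hp
      obtain ⟨b1, b2⟩ := hg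
      rcases hT0.eq_or_lt with h0 | h0
      · obtain rfl : t = 0 := by linarith
        simpa [field] using ⟨a1, a2, a3⟩
      · have e1 : T * (p.1 + t * (v * Real.cos θ)) = (T - t) * p.1 + t * g := by
          linear_combination t * hc
        have e2 : T * (p.2 + t * (v * Real.sin θ)) = (T - t) * p.2 := by
          linear_combination t * hs
        have hTt : 0 ≤ T - t := by linarith
        refine ⟨?_, ?_, ?_⟩
        · refine nonneg_of_mul_nonneg_right ?_ h0
          simp only; rw [e1]; positivity
        · refine le_of_mul_le_mul_left ?_ h0
          simp only; rw [e1]; nlinarith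
        · refine nonneg_of_mul_nonneg_right ?_ h0
          simp only; rw [e2]; positivity
    · rw [hpos' t h]
      exact ⟨hg.1, hg.2, mul_nonneg hv.le (by linarith)⟩
  · have : p.1 - g = -(v * T * Real.cos θ) := by linarith
    rw [this, show p.2 = -(v * T * Real.sin θ) by linarith]
    linear_combination (v * T) ^ 2 * Real.cos_sq_add_sin_sq θ
  · rw [hpos t h0 h1]
    have e1 : p.1 + t * (v * Real.cos θ) - g = -(v * (T - t) * Real.cos θ) := by linarith
    have e2 : p.2 + t * (v * Real.sin θ) = -(v * (T - t) * Real.sin θ) := by linarith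
    simp only
    rw [e1, e2]
    linear_combination (v * (T - t)) ^ 2 * Real.cos_sq_add_sin_sq θ

theorem sq_add_sq_le_of_add {a b c d r s : ℝ} (hr : 0 ≤ r) (hs : 0 ≤ s)
    (h1 : a ^ 2 + b ^ 2 ≤ r ^ 2) (h2 : c ^ 2 + d ^ 2 ≤ s ^ 2) :
    (a + c) ^ 2 + (b + d) ^ 2 ≤ (r + s) ^ 2 := by
  have : a * c + b * d ≤ r * s := by
    refine (abs_le_of_sq_le_sq' ?_ (mul_nonneg hr hs)).2
    nlinarith [sq_nonneg (a * d - b * c), mul_le_mul h1 h2 (by positivity) (by positivity)]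
  nlinarith

/-- A pursuer that meets the evader during its straight run to `(g, 0)` could have been at `(g, 0)`
before the evader. -/
theorem sq_dist_le_of_meets_run {v w T t g : ℝ} {p P : ℝ × ℝ} {φ ψ : ℝ → ℝ} (hv : 0 < v)
    (hvw : v < w) (hψ : Measurable ψ) (h0 : 0 ≤ t) (h1 : t ≤ T)
    (hrun : ((position v p φ t).1 - g) ^ 2 + (position v p φ t).2 ^ 2 = (v * (T - t)) ^ 2)
    (hmeet : position w P ψ t = position v p φ t) :
    (P.1 - g) ^ 2 + P.2 ^ 2 ≤ (w * t + v * (T - t)) ^ 2 := by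
  have h2 := sq_dist_position_le (hv.trans hvw).le h0 hψ P
  rw [hmeet] at h2
  set q := position v p φ t
  have := sq_add_sq_le_of_add (a := P.1 - q.1) (b := P.2 - q.2) (c := q.1 - g) (d := q.2)
    (mul_nonneg (hv.trans hvw).le h0) (mul_nonneg hv.le (by linarith : 0 ≤ T - t))
    (by linarith [sub_sq_comm P.1 q.1, sub_sq_comm P.2 q.2]) hrun.le
  simpa using this

/-! ### Parallel pursuit -/

/-- `γ² |P - q|² - |E - q|²`: with `γ` the ratio of the speeds, it is positive if a player at `E`
reaches `q` before a player at `P`. -/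
def advantage (γ : ℝ) (E P q : ℝ × ℝ) : ℝ :=
  γ ^ 2 * ((P.1 - q.1) ^ 2 + (P.2 - q.2) ^ 2) - ((E.1 - q.1) ^ 2 + (E.2 - q.2) ^ 2)

/-- The component of the direction `θ` along the vector `n`. -/
def alongComp (n : ℝ × ℝ) (θ : ℝ) : ℝ := n.1 * Real.cos θ + n.2 * Real.sin θ

/-- The component of the direction `θ` orthogonal to the vector `n`. -/
def lateralComp (n : ℝ × ℝ) (θ : ℝ) : ℝ := n.1 * Real.sin θ - n.2 * Real.cos θ

/-- The component along the line of sight of the velocity of a pursuer with speed `w` that has the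
same lateral velocity as an evader with speed `v` and heading `θ`. -/
def closingComp (v w : ℝ) (n : ℝ × ℝ) (θ : ℝ) : ℝ := √(w ^ 2 - (v * lateralComp n θ) ^ 2)

/-- The abscissa of the direction of parallel pursuit. -/
def pursuitCos (v w : ℝ) (n : ℝ × ℝ) (θ : ℝ) : ℝ :=
  (closingComp v w n θ * n.1 - v * lateralComp n θ * n.2) / w

/-- The ordinate of the direction of parallel pursuit. -/
def pursuitSin (v w : ℝ) (n : ℝ × ℝ) (θ : ℝ) : ℝ :=
  (closingComp v w n θ * n.2 + v * lateralComp n θ * n.1) / w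

/-- The parallel pursuit in the plane, folded into the field. -/
def foldedPursuit (L v w : ℝ) (n P : ℝ × ℝ) (φ : ℝ → ℝ) (s : ℝ) : ℝ :=
  heading
    (foldSign (triangleWave L) (P.1 + ∫ r in (0 : ℝ)..s, w * pursuitCos v w n (φ r))
      * pursuitCos v w n (φ s))
    (foldSign (fun y => |y|) (P.2 + ∫ r in (0 : ℝ)..s, w * pursuitSin v w n (φ r))
      * pursuitSin v w n (φ s))

section
variable {v w : ℝ} {n : ℝ × ℝ}

theorem sq_alongComp_add_sq_lateralComp (hn : n.1 ^ 2 + n.2 ^ 2 = 1) (θ : ℝ) :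
    alongComp n θ ^ 2 + lateralComp n θ ^ 2 = 1 := by
  unfold alongComp lateralComp
  linear_combination (n.1 ^ 2 + n.2 ^ 2) * Real.cos_sq_add_sin_sq θ + hn

theorem sq_closingComp (hv : 0 < v) (hvw : v < w) (hn : n.1 ^ 2 + n.2 ^ 2 = 1) (θ : ℝ) :
    closingComp v w n θ ^ 2 = w ^ 2 - (v * lateralComp n θ) ^ 2 := by
  refine Real.sq_sqrt ?_
  nlinarith [sq_alongComp_add_sq_lateralComp hn θ, sq_nonneg (alongComp n θ), sq_nonneg v,
    mul_nonneg (sq_nonneg v) (sq_nonneg (alongComp n θ))]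

theorem sq_pursuit (hv : 0 < v) (hvw : v < w) (hn : n.1 ^ 2 + n.2 ^ 2 = 1) (θ : ℝ) :
    pursuitCos v w n θ ^ 2 + pursuitSin v w n θ ^ 2 = 1 := by
  have hw : w ≠ 0 := (hv.trans hvw).ne'
  unfold pursuitCos pursuitSin
  field_simp
  linear_combination sq_closingComp hv hvw hn θ
    + (closingComp v w n θ ^ 2 + (v * lateralComp n θ) ^ 2) * hn

theorem le_closing_speed (hv : 0 < v) (hvw : v < w) (hn : n.1 ^ 2 + n.2 ^ 2 = 1) (θ : ℝ) :
    w - v ≤ closingComp v w n θ - v * alongComp n θ := by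
  have h1 := sq_alongComp_add_sq_lateralComp hn θ
  have h2 : alongComp n θ ≤ 1 := by nlinarith [sq_nonneg (lateralComp n θ)]
  have : w - v + v * alongComp n θ ≤ closingComp v w n θ := by
    refine Real.le_sqrt_of_sq_le ?_
    have h3 : (v * lateralComp n θ) ^ 2 = v ^ 2 - v ^ 2 * alongComp n θ ^ 2 := by
      linear_combination v ^ 2 * h1
    rw [h3]
    nlinarith [mul_nonneg (mul_nonneg hv.le (sub_nonneg.2 hvw.le)) (sub_nonneg.2 h2)]
  linarith

theorem abs_mul_pursuitCos_le (hv : 0 < v) (hvw : v < w) (hn : n.1 ^ 2 + n.2 ^ 2 = 1) (θ : ℝ) :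
    |w * pursuitCos v w n θ| ≤ w := by
  rw [abs_mul, abs_of_pos (hv.trans hvw)]
  refine mul_le_of_le_one_right (hv.trans hvw).le (abs_le_one_iff_mul_self_le_one.2 ?_)
  nlinarith [sq_pursuit hv hvw hn θ, sq_nonneg (pursuitSin v w n θ)]

theorem abs_mul_pursuitSin_le (hv : 0 < v) (hvw : v < w) (hn : n.1 ^ 2 + n.2 ^ 2 = 1) (θ : ℝ) :
    |w * pursuitSin v w n θ| ≤ w := by
  rw [abs_mul, abs_of_pos (hv.trans hvw)]
  refine mul_le_of_le_one_right (hv.trans hvw).le (abs_le_one_iff_mul_self_le_one.2 ?_)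
  nlinarith [sq_pursuit hv hvw hn θ, sq_nonneg (pursuitCos v w n θ)]

theorem measurable_lateralComp : Measurable (lateralComp n) := by unfold lateralComp; fun_prop

theorem measurable_closingComp : Measurable (closingComp v w n) := by
  have := measurable_lateralComp (n := n)
  unfold closingComp; fun_prop

theorem measurable_pursuitCos : Measurable (pursuitCos v w n) := by
  have := measurable_lateralComp (n := n)
  have := measurable_closingComp (v := v) (w := w) (n := n)
  unfold pursuitCos; fun_prop

theorem measurable_pursuitSin : Measurable (pursuitSin v w n) := by
  have := measurable_lateralComp (n := n)
  have := measurable_closingComp (v := v) (w := w) (n := n)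
  unfold pursuitSin; fun_prop

/-- The folded pursuit moves along the image of the parallel pursuit. -/
theorem foldedPursuit_direction {L : ℝ} (hv : 0 < v) (hvw : v < w)
    (hn : n.1 ^ 2 + n.2 ^ 2 = 1) (P : ℝ × ℝ) (φ : ℝ → ℝ) (s : ℝ) :
    Real.cos (foldedPursuit L v w n P φ s)
      = foldSign (triangleWave L) (P.1 + ∫ r in (0 : ℝ)..s, w * pursuitCos v w n (φ r))
        * pursuitCos v w n (φ s) ∧
    Real.sin (foldedPursuit L v w n P φ s)
      = foldSign (fun y => |y|) (P.2 + ∫ r in (0 : ℝ)..s, w * pursuitSin v w n (φ r))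
        * pursuitSin v w n (φ s) := by
  refine ⟨cos_heading ?_, sin_heading ?_⟩ <;>
    rw [mul_pow, mul_pow, foldSign_sq, foldSign_sq, one_mul, one_mul, sq_pursuit hv hvw hn]

theorem position_foldedPursuit {L : ℝ} (hL : 0 < L) (hv : 0 < v) (hvw : v < w)
    (hn : n.1 ^ 2 + n.2 ^ 2 = 1) {P : ℝ × ℝ} (hP : triangleWave L P.1 = P.1 ∧ |P.2| = P.2)
    {φ : ℝ → ℝ} (hφ : Measurable φ) (t : ℝ) :
    position w P (foldedPursuit L v w n P φ) t =
      (triangleWave L (P.1 + ∫ r in (0 : ℝ)..t, w * pursuitCos v w n (φ r)),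
        |P.2 + ∫ r in (0 : ℝ)..t, w * pursuitSin v w n (φ r)|) := by
  have hc : Measurable fun r => w * pursuitCos v w n (φ r) :=
    (measurable_pursuitCos.comp hφ).const_mul w
  have hs : Measurable fun r => w * pursuitSin v w n (φ r) :=
    (measurable_pursuitSin.comp hφ).const_mul w
  have h1 := (isFold_triangleWave hL).integral hc
    (fun r => abs_mul_pursuitCos_le hv hvw hn (φ r)) P.1 t
  have h2 := isFold_abs.integral hs (fun r => abs_mul_pursuitSin_le hv hvw hn (φ r)) P.2 t
  rw [← h1, ← h2, hP.1, hP.2]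
  unfold position
  simp only [foldedPursuit_direction hv hvw hn, mul_left_comm w]

theorem measurable_foldedPursuit {L : ℝ} (hv : 0 < v) (hvw : v < w)
    (hn : n.1 ^ 2 + n.2 ^ 2 = 1) (P : ℝ × ℝ) {φ : ℝ → ℝ} (hφ : Measurable φ) :
    Measurable (foldedPursuit L v w n P φ) := by
  have hc : Measurable fun r => w * pursuitCos v w n (φ r) :=
    (measurable_pursuitCos.comp hφ).const_mul w
  have hs : Measurable fun r => w * pursuitSin v w n (φ r) :=
    (measurable_pursuitSin.comp hφ).const_mul w
  have hX := (intervalIntegral.continuous_primitive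
    (intervalIntegrable_of_abs_le hc fun r => abs_mul_pursuitCos_le hv hvw hn (φ r)) 0).measurable
  have hY := (intervalIntegral.continuous_primitive
    (intervalIntegrable_of_abs_le hs fun r => abs_mul_pursuitSin_le hv hvw hn (φ r)) 0).measurable
  exact measurable_heading
    (((measurable_foldSign _).comp (hX.const_add _)).mul (measurable_pursuitCos.comp hφ))
    (((measurable_foldSign _).comp (hY.const_add _)).mul (measurable_pursuitSin.comp hφ))

theorem agreeUpTo_foldedPursuit {L t : ℝ} {P : ℝ × ℝ} {φ φ' : ℝ → ℝ} (h : AgreeUpTo t φ φ') :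
    AgreeUpTo t (foldedPursuit L v w n P φ) (foldedPursuit L v w n P φ') := by
  filter_upwards [h, ae_restrict_mem measurableSet_Icc] with s hs hmem
  unfold foldedPursuit
  rw [hs, (h.mono hmem.2).integral_comp hmem.1 (fun θ => w * pursuitCos v w n θ),
    (h.mono hmem.2).integral_comp hmem.1 (fun θ => w * pursuitSin v w n θ)]

end

theorem fold_eq_of_mem_field {G : Game} (hG : 0 < G.xbar) {p : ℝ × ℝ} (hp : p ∈ field G) :
    triangleWave G.xbar p.1 = p.1 ∧ |p.2| = p.2 := by
  obtain ⟨h1, h2, h3⟩ := hp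
  refine ⟨?_, abs_of_nonneg h3⟩
  rw [triangleWave_eq_abs hG (by rwa [abs_of_nonneg h1]), abs_of_nonneg h1]

/-- A unit vector in the direction from `P` to `E`. -/
theorem exists_unit_line_of_sight (E P : ℝ × ℝ) :
    ∃ (n : ℝ × ℝ) (d : ℝ), n.1 ^ 2 + n.2 ^ 2 = 1 ∧ 0 ≤ d ∧
      E.1 - P.1 = d * n.1 ∧ E.2 - P.2 = d * n.2 := by
  set z : ℂ := ⟨E.1 - P.1, E.2 - P.2⟩ with hz
  exact ⟨(Real.cos z.arg, Real.sin z.arg), ‖z‖, Real.cos_sq_add_sin_sq _, norm_nonneg _,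
    (Complex.norm_mul_cos_arg z).symm, (Complex.norm_mul_sin_arg z).symm⟩

/-- A single pursuer with larger speed has a strategy that captures the evader within a bounded
time, and until then the evader stays in the initial Apollonius disc, in its interior before the
capture. -/
theorem exists_pursuit {G : Game} (hG : 0 < G.xbar) {v w : ℝ} (hv : 0 < v) (hvw : v < w)
    (E : ℝ × ℝ) {P : ℝ × ℝ} (hP : P ∈ field G) :
    ∃ (β : (ℝ → ℝ) → (ℝ → ℝ)) (M : ℝ),
      (∀ φ, Admissible G v E φ → Admissible G w P (β φ)) ∧
      (∀ φ φ' t, AgreeUpTo t φ φ' → AgreeUpTo t (β φ) (β φ')) ∧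
      ∀ φ, Admissible G v E φ → ∃ T, 0 ≤ T ∧ T ≤ M ∧
        position w P (β φ) T = position v E φ T ∧
        (∀ t, 0 ≤ t → t ≤ T → 0 ≤ advantage (v / w) E P (position v E φ t)) ∧
        ∀ t, 0 ≤ t → t < T → 0 < advantage (v / w) E P (position v E φ t) := by
  obtain ⟨n, d, hn, hd, hd1, hd2⟩ := exists_unit_line_of_sight E P
  have hw : 0 < w := hv.trans hvw
  refine ⟨foldedPursuit G.xbar v w n P, d / (w - v), fun φ hφ => ?_,
    fun φ φ' t h => agreeUpTo_foldedPursuit h, fun φ hφ => ?_⟩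
  · refine ⟨measurable_foldedPursuit hv hvw hn P hφ.measurable, fun t => heading_mem_Icc _ _,
      fun t _ => ?_⟩
    rw [position_foldedPursuit hG hv hvw hn (fold_eq_of_mem_field hG hP) hφ.measurable]
    exact ⟨(triangleWave_mem_Icc hG _).1, (triangleWave_mem_Icc hG _).2, abs_nonneg _⟩
  have hm := hφ.measurable
  have icos := intervalIntegrable_speed_cos hm v
  have isin := intervalIntegrable_speed_sin hm v
  have ik : ∀ a b, IntervalIntegrable (fun s => closingComp v w n (φ s)) volume a b :=
    intervalIntegrable_of_abs_le (M := w) (measurable_closingComp.comp hm) fun s => by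
      rw [closingComp, abs_of_nonneg (Real.sqrt_nonneg _)]
      refine Real.sqrt_le_iff.2 ⟨hw.le, ?_⟩
      linarith [sq_nonneg (v * lateralComp n (φ s))]
  have ial : ∀ a b, IntervalIntegrable (fun s => v * alongComp n (φ s)) volume a b := fun a b => by
    refine (((icos a b).const_mul n.1).add ((isin a b).const_mul n.2)).congr ?_
    exact fun s _ => by simp only [alongComp]; ring
  have ilat : ∀ a b, IntervalIntegrable (fun s => v * lateralComp n (φ s)) volume a b :=
    fun a b => by
      refine (((isin a b).const_mul n.1).sub ((icos a b).const_mul n.2)).congr ?_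
      exact fun s _ => by simp only [lateralComp]; ring
  set C : ℝ → ℝ := fun t => ∫ s in (0 : ℝ)..t, v * Real.cos (φ s) with hC
  set S : ℝ → ℝ := fun t => ∫ s in (0 : ℝ)..t, v * Real.sin (φ s) with hS
  set K : ℝ → ℝ := fun t => ∫ s in (0 : ℝ)..t, closingComp v w n (φ s) with hK
  have hA : ∀ t, ∫ s in (0 : ℝ)..t, v * alongComp n (φ s) = n.1 * C t + n.2 * S t := fun t => by
    rw [hC, hS, ← intervalIntegral.integral_const_mul, ← intervalIntegral.integral_const_mul,
      ← intervalIntegral.integral_add ((icos 0 t).const_mul n.1) ((isin 0 t).const_mul n.2)]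
    exact intervalIntegral.integral_congr fun s _ => by simp only [alongComp]; ring
  have hB : ∀ t, ∫ s in (0 : ℝ)..t, v * lateralComp n (φ s) = n.1 * S t - n.2 * C t := fun t => by
    rw [hC, hS, ← intervalIntegral.integral_const_mul, ← intervalIntegral.integral_const_mul,
      ← intervalIntegral.integral_sub ((isin 0 t).const_mul n.1) ((icos 0 t).const_mul n.2)]
    exact intervalIntegral.integral_congr fun s _ => by simp only [lateralComp]; ring
  have hPC : ∀ t, ∫ s in (0 : ℝ)..t, w * pursuitCos v w n (φ s)
      = n.1 * K t - n.2 * (n.1 * S t - n.2 * C t) := fun t => by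
    rw [← hB, hK, ← intervalIntegral.integral_const_mul, ← intervalIntegral.integral_const_mul,
      ← intervalIntegral.integral_sub ((ik 0 t).const_mul n.1) ((ilat 0 t).const_mul n.2)]
    refine intervalIntegral.integral_congr fun s _ => ?_
    simp only [pursuitCos]; field_simp
  have hPS : ∀ t, ∫ s in (0 : ℝ)..t, w * pursuitSin v w n (φ s)
      = n.2 * K t + n.1 * (n.1 * S t - n.2 * C t) := fun t => by
    rw [← hB, hK, ← intervalIntegral.integral_const_mul, ← intervalIntegral.integral_const_mul,
      ← intervalIntegral.integral_add ((ik 0 t).const_mul n.2) ((ilat 0 t).const_mul n.1)]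
    refine intervalIntegral.integral_congr fun s _ => ?_
    simp only [pursuitSin]; field_simp
  have hbound : ∀ t, 0 ≤ t →
      w ^ 2 * (n.1 * C t + n.2 * S t) ^ 2 + (w ^ 2 - v ^ 2) * (n.1 * S t - n.2 * C t) ^ 2
        ≤ (v * K t) ^ 2 := fun t ht => by
    have := sq_integral_add_sq_integral_le ht ((ial 0 t).const_mul w)
      ((ilat 0 t).const_mul (√(w ^ 2 - v ^ 2))) ((ik 0 t).const_mul v)
      (fun s => mul_nonneg hv.le (Real.sqrt_nonneg _)) (fun s => by
        rw [mul_pow, mul_pow _ (v * _), Real.sq_sqrt (by nlinarith), mul_pow v (closingComp _ _ _ _),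
          sq_closingComp hv hvw hn]
        exact le_of_eq (by
          linear_combination v ^ 2 * w ^ 2 * sq_alongComp_add_sq_lateralComp hn (φ s)))
    have e1 : ∫ s in (0 : ℝ)..t, w * (v * alongComp n (φ s)) = w * (n.1 * C t + n.2 * S t) := by
      rw [intervalIntegral.integral_const_mul, hA]
    have e2 : ∫ s in (0 : ℝ)..t, √(w ^ 2 - v ^ 2) * (v * lateralComp n (φ s))
        = √(w ^ 2 - v ^ 2) * (n.1 * S t - n.2 * C t) := by
      rw [intervalIntegral.integral_const_mul, hB]
    rw [e1, e2, intervalIntegral.integral_const_mul, mul_pow, mul_pow (√_),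
      Real.sq_sqrt (by nlinarith)] at this
    exact this
  -- the distance from the unfolded pursuer to the evader
  set gap : ℝ → ℝ := fun t => d + (n.1 * C t + n.2 * S t) - K t with hgap
  have hgap_sub : ∀ s t, s ≤ t → gap t + (w - v) * (t - s) ≤ gap s := fun s t hst => by
    have e : gap s - gap t = ∫ r in s..t, (closingComp v w n (φ r) - v * alongComp n (φ r)) := by
      rw [intervalIntegral.integral_sub (ik s t) (ial s t),
        ← intervalIntegral.integral_interval_sub_left (ik 0 t) (ik 0 s),
        ← intervalIntegral.integral_interval_sub_left (ial 0 t) (ial 0 s), hA, hA]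
      simp only [hgap, hK]; ring
    have := intervalIntegral.integral_mono_on hst (intervalIntegrable_const (c := w - v))
      ((ik s t).sub (ial s t)) fun r _ => le_closing_speed hv hvw hn (φ r)
    rw [← e, intervalIntegral.integral_const, smul_eq_mul] at this
    linarith
  have hgap_cont : Continuous gap := by
    have := intervalIntegral.continuous_primitive icos 0
    have := intervalIntegral.continuous_primitive isin 0
    have := intervalIntegral.continuous_primitive ik 0
    simp only [hgap, hC, hS, hK]
    fun_prop
  have hgap0 : gap 0 = d := by simp [hgap, hC, hS, hK]
  have hwv : 0 < w - v := by linarith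
  obtain ⟨T, ⟨hT0, hTM⟩, hT⟩ : (0 : ℝ) ∈ gap '' Set.Icc 0 (d / (w - v)) := by
    refine intermediate_value_Icc' (by positivity) hgap_cont.continuousOn ⟨?_, hgap0 ▸ hd⟩
    have := hgap_sub 0 (d / (w - v)) (by positivity)
    rw [hgap0, sub_zero, mul_div_cancel₀ _ hwv.ne'] at this
    linarith
  have hadv : ∀ t, w ^ 2 * advantage (v / w) E P (position v E φ t)
      = v ^ 2 * (K t + gap t) ^ 2
        - (w ^ 2 * (n.1 * C t + n.2 * S t) ^ 2 + (w ^ 2 - v ^ 2) * (n.1 * S t - n.2 * C t) ^ 2) :=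
    fun t => by
      have e1 : P.1 - (position v E φ t).1 = -(d * n.1 + C t) := by
        simp only [position, hC]; linarith
      have e2 : P.2 - (position v E φ t).2 = -(d * n.2 + S t) := by
        simp only [position, hS]; linarith
      have e3 : E.1 - (position v E φ t).1 = -C t := by simp only [position, hC]; ring
      have e4 : E.2 - (position v E φ t).2 = -S t := by simp only [position, hS]; ring
      simp only [advantage]
      rw [e1, e2, e3, e4]
      simp only [hgap]
      rw [mul_sub, ← mul_assoc, ← mul_pow, mul_div_cancel₀ _ hw.ne']
      linear_combination (v ^ 2 * d ^ 2 - (v ^ 2 - w ^ 2) * (C t ^ 2 + S t ^ 2)) * hn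
  have hgap_nonneg : ∀ t, 0 ≤ t → t ≤ T → 0 ≤ gap t := fun t _ h => by
    nlinarith [hgap_sub t T h]
  have hK0 : ∀ t, 0 ≤ t → 0 ≤ K t := fun t ht =>
    intervalIntegral.integral_nonneg ht fun s _ => Real.sqrt_nonneg _
  refine ⟨T, hT0, hTM, ?_, fun t h0 h1 => ?_, fun t h0 h1 => ?_⟩
  · rw [position_foldedPursuit hG hv hvw hn (fold_eq_of_mem_field hG hP) hm, hPC, hPS]
    have hf := fold_eq_of_mem_field hG (hφ.mem_field T hT0)
    have hKT : K T = d + (n.1 * C T + n.2 * S T) := by simp only [hgap] at hT; linarith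
    have e1 : P.1 + (n.1 * K T - n.2 * (n.1 * S T - n.2 * C T)) = (position v E φ T).1 := by
      simp only [position]
      linear_combination C T * hn - hd1 + n.1 * hKT
    have e2 : P.2 + (n.2 * K T + n.1 * (n.1 * S T - n.2 * C T)) = (position v E φ T).2 := by
      simp only [position]
      linear_combination S T * hn - hd2 + n.2 * hKT
    rw [e1, e2, hf.1, hf.2]
  · have h2 := hgap_nonneg t h0 h1
    have h3 := hK0 t h0
    refine nonneg_of_mul_nonneg_right (?_ : 0 ≤ w ^ 2 * _) (by positivity)
    have h4 : 0 ≤ v ^ 2 * (2 * K t * gap t + gap t ^ 2) := by positivity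
    rw [hadv]
    linarith [hbound t h0]
  · have h2 : 0 < gap t := by nlinarith [hgap_sub t T h1.le]
    have h3 := hK0 t h0
    refine pos_of_mul_pos_right (?_ : 0 < w ^ 2 * _) (by positivity)
    have h4 : 0 < v ^ 2 * (2 * K t * gap t + gap t ^ 2) := by positivity
    rw [hadv]
    linarith [hbound t h0]

/-! ### Apollonius circles and the goal line -/

theorem mem_apolloniusCircle_iff {c : ℝ} (h0 : 0 < c) (h1 : c < 1) (A B p : ℝ × ℝ) :
    p ∈ apolloniusCircle c A B ↔ advantage c A B p = 0 := by
  have hc : 1 - c ^ 2 ≠ 0 := by nlinarith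
  have hs := Real.sq_sqrt (by positivity : 0 ≤ (A.1 - B.1) ^ 2 + (A.2 - B.2) ^ 2)
  have key : advantage c A B p = -(1 - c ^ 2) *
      ((p.1 - apolloniusAbscissa c A B) ^ 2 + (p.2 - apolloniusOrdinate c A B) ^ 2
        - apolloniusRadius c A B ^ 2) := by
    rw [apolloniusRadius, mul_pow, hs]
    unfold advantage apolloniusAbscissa apolloniusOrdinate
    field_simp
    ring
  rw [key, apolloniusCircle, Set.mem_ofPred_eq, mul_eq_zero, neg_eq_zero, or_iff_right hc,
    sub_eq_zero]

theorem advantage_sub_advantage (c : ℝ) (E P : ℝ × ℝ) (g h : ℝ) :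
    advantage c E P (g, 0) - advantage c E P (h, 0) =
      2 * ((g - h) * (E.1 - c ^ 2 * P.1 - (1 - c ^ 2) * h)) - (1 - c ^ 2) * (g - h) ^ 2 := by
  unfold advantage; ring

theorem advantage_eq_at_centre {c : ℝ} (hc : 1 - c ^ 2 ≠ 0) (E P : ℝ × ℝ) :
    (1 - c ^ 2) * advantage c E P (apolloniusAbscissa c E P, 0) =
      c ^ 2 * (P.1 ^ 2 + (1 - c ^ 2) * P.2 ^ 2) + c ^ 2 * E.1 ^ 2
        - (1 - c ^ 2) * E.2 ^ 2 - 2 * c ^ 2 * P.1 * E.1 := by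
  unfold advantage apolloniusAbscissa
  field_simp
  ring

theorem advantage_eq_centre_sub {c : ℝ} (hc : 1 - c ^ 2 ≠ 0) (E P : ℝ × ℝ) (g : ℝ) :
    advantage c E P (g, 0) = advantage c E P (apolloniusAbscissa c E P, 0)
      - (1 - c ^ 2) * (g - apolloniusAbscissa c E P) ^ 2 := by
  unfold advantage apolloniusAbscissa
  field_simp
  ring

theorem tangentToGoalLine_iff {G : Game} {c : ℝ} (h0 : 0 < c) (h1 : c < 1) {E P : ℝ × ℝ}
    (hm : apolloniusAbscissa c E P ∈ Set.Icc 0 G.xbar) :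
    TangentToGoalLine G (apolloniusCircle c E P) ↔
      advantage c E P (apolloniusAbscissa c E P, 0) = 0 := by
  have hc : 0 < 1 - c ^ 2 := by nlinarith
  set m := apolloniusAbscissa c E P with hmdef
  have hmem : ∀ g : ℝ, (g, (0 : ℝ)) ∈ apolloniusCircle c E P ↔
      advantage c E P (m, 0) = (1 - c ^ 2) * (g - m) ^ 2 := fun g => by
    rw [mem_apolloniusCircle_iff h0 h1, advantage_eq_centre_sub hc.ne' E P g, sub_eq_zero]
  constructor
  · rintro ⟨⟨a, b⟩, -, heq⟩
    have hab : (a, b) ∈ apolloniusCircle c E P ∩ {q | q.2 = 0} := heq ▸ Set.mem_singleton _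
    obtain rfl : b = 0 := hab.2
    have h2 := (hmem a).1 hab.1
    -- the mirror image of `a` is on the circle as well
    have h3 : (2 * m - a, (0 : ℝ)) ∈ apolloniusCircle c E P ∩ {q | q.2 = 0} :=
      ⟨(hmem _).2 (by rw [h2]; ring), rfl⟩
    rw [heq] at h3
    have h4 : 2 * m - a = a := congrArg Prod.fst (Set.mem_singleton_iff.1 h3)
    rw [h2, show a - m = 0 by linarith]
    ring
  · intro h
    refine ⟨(m, 0), ⟨⟨hm.1, hm.2, le_rfl⟩, rfl⟩, ?_⟩
    ext ⟨a, b⟩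
    simp only [Set.mem_inter_iff, Set.mem_ofPred_eq, Set.mem_singleton_iff, Prod.mk.injEq]
    constructor
    · rintro ⟨h2, rfl⟩
      rw [hmem, h] at h2
      have h3 : (a - m) ^ 2 = 0 := by
        rcases mul_eq_zero.1 h2.symm with h | h
        · exact absurd h hc.ne'
        · exact h
      exact ⟨by linarith [pow_eq_zero_iff two_ne_zero |>.1 h3], rfl⟩
    · rintro ⟨rfl, rfl⟩
      exact ⟨(hmem _).2 (by rw [h]; ring), rfl⟩

theorem advantage_nonneg_of_travelTime_le {v w : ℝ} (hv : 0 < v) (hw : 0 < w) {A B q : ℝ × ℝ}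
    (h : travelTime v A q ≤ travelTime w B q) : 0 ≤ advantage (v / w) A B q := by
  unfold travelTime at h
  rw [div_le_div_iff₀ hv hw] at h
  have h2 := pow_le_pow_left₀ (by positivity) h 2
  rw [mul_pow, mul_pow, Real.sq_sqrt (by positivity), Real.sq_sqrt (by positivity)] at h2
  unfold advantage
  rw [div_pow, div_mul_eq_mul_div, sub_nonneg, le_div_iff₀ (by positivity)]
  linarith

theorem advantage_trans {u v w : ℝ} (hv : 0 < v) (hw : 0 < w) (A B C q : ℝ × ℝ) :
    advantage (u / w) A C q
      = advantage (u / v) A B q + (u / v) ^ 2 * advantage (v / w) B C q := by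
  unfold advantage
  field_simp
  ring

theorem advantage_nonpos_of_travelTime_le {v w : ℝ} (hv : 0 < v) (hw : 0 < w) {A B q : ℝ × ℝ}
    (h : travelTime w B q ≤ travelTime v A q) : advantage (v / w) A B q ≤ 0 := by
  have h1 := advantage_nonneg_of_travelTime_le hw hv h
  have h2 : advantage (v / w) A B q = -((v / w) ^ 2 * advantage (w / v) B A q) := by
    unfold advantage
    field_simp
    ring
  rw [h2]
  exact neg_nonpos.2 (by positivity)

/-! ### The common boundary of the two pursuers on the goal line -/

/-- The speeds are positive and ordered. -/
structure Game.Ordered (G : Game) : Prop where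
  xbar_pos : 0 < G.xbar
  vE_pos : 0 < G.vE
  vE_lt : G.vE < G.v1
  v1_lt : G.v1 < G.v2

namespace Game.Ordered
variable {G : Game}

theorem v1_pos (hG : G.Ordered) : 0 < G.v1 := hG.vE_pos.trans hG.vE_lt
theorem v2_pos (hG : G.Ordered) : 0 < G.v2 := hG.v1_pos.trans hG.v1_lt
theorem vE_lt_v2 (hG : G.Ordered) : G.vE < G.v2 := hG.vE_lt.trans hG.v1_lt
theorem γ₁_pos (hG : G.Ordered) : 0 < γ₁ G := div_pos hG.vE_pos hG.v1_pos
theorem γ₂_pos (hG : G.Ordered) : 0 < γ₂ G := div_pos hG.vE_pos hG.v2_pos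
theorem γ_pos (hG : G.Ordered) : 0 < γ G := div_pos hG.v1_pos hG.v2_pos
theorem γ₁_lt_one (hG : G.Ordered) : γ₁ G < 1 := (div_lt_one hG.v1_pos).2 hG.vE_lt
theorem γ₂_lt_one (hG : G.Ordered) : γ₂ G < 1 := (div_lt_one hG.v2_pos).2 hG.vE_lt_v2
theorem γ_lt_one (hG : G.Ordered) : γ G < 1 := (div_lt_one hG.v2_pos).2 hG.v1_lt
theorem one_sub_γ₁_sq_pos (hG : G.Ordered) : 0 < 1 - γ₁ G ^ 2 := by
  nlinarith [hG.γ₁_pos, hG.γ₁_lt_one]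
theorem one_sub_γ₂_sq_pos (hG : G.Ordered) : 0 < 1 - γ₂ G ^ 2 := by
  nlinarith [hG.γ₂_pos, hG.γ₂_lt_one]
theorem one_sub_γ_sq_pos (hG : G.Ordered) : 0 < 1 - γ G ^ 2 := by
  nlinarith [hG.γ_pos, hG.γ_lt_one]
theorem γ₁_mul_γ (hG : G.Ordered) : γ₁ G * γ G = γ₂ G := by
  unfold γ₁ γ γ₂
  have := hG.v1_pos.ne'
  field_simp

end Game.Ordered

/-- The advantage of the evader over `P₁` at `(g, 0)`. -/
def goalAdv1 (G : Game) (x : State) (g : ℝ) : ℝ := advantage (γ₁ G) x.E x.P1 (g, 0)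

/-- The advantage of the evader over `P₂` at `(g, 0)`. -/
def goalAdv2 (G : Game) (x : State) (g : ℝ) : ℝ := advantage (γ₂ G) x.E x.P2 (g, 0)

/-- The advantage of `P₁` over `P₂` at `(g, 0)`. -/
def goalAdv12 (G : Game) (x : State) (g : ℝ) : ℝ := advantage (γ G) x.P1 x.P2 (g, 0)

theorem goalAdv2_eq {G : Game} (hG : G.Ordered) (x : State) (g : ℝ) :
    goalAdv2 G x g = goalAdv1 G x g + γ₁ G ^ 2 * goalAdv12 G x g :=
  advantage_trans hG.v1_pos hG.v2_pos _ _ _ _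

/-- The facts about `x_I` on which the analysis of the Barrier function rests. -/
structure Crossing (G : Game) (x : State) : Prop where
  radicand_nonneg : 0 ≤ radicand G x
  xI_nonneg : 0 ≤ xI G x
  xI_le : xI G x ≤ G.xbar
  eq_zero : goalAdv12 G x (xI G x) = 0
  le_xI : ∀ g, goalAdv12 G x g = 0 → g ≤ xI G x
  left : ∀ g, 0 ≤ g → g ≤ xI G x → 0 ≤ goalAdv12 G x g
  right : ∀ g, xI G x ≤ g → goalAdv12 G x g ≤ 0

theorem crossing {G : Game} (hG : G.Ordered) {x : State}
    (hleft : travelTime G.v1 x.P1 (0, 0) ≤ travelTime G.v2 x.P2 (0, 0))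
    (hright : travelTime G.v2 x.P2 (G.xbar, 0) ≤ travelTime G.v1 x.P1 (G.xbar, 0)) :
    Crossing G x := by
  have hc := hG.one_sub_γ_sq_pos
  have hx := hG.xbar_pos
  have h0 : 0 ≤ goalAdv12 G x 0 := advantage_nonneg_of_travelTime_le hG.v1_pos hG.v2_pos hleft
  have h1 : goalAdv12 G x G.xbar ≤ 0 := advantage_nonpos_of_travelTime_le hG.v1_pos hG.v2_pos hright
  have hrad : radicand G x = (1 - γ G ^ 2) * goalAdv12 G x 0
      + (x.P1.1 - γ G ^ 2 * x.P2.1) ^ 2 := by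
    simp only [radicand, goalAdv12, advantage]; ring
  have hr0 : 0 ≤ radicand G x := by rw [hrad]; positivity
  have hs := Real.sq_sqrt hr0
  have hs0 := Real.sqrt_nonneg (radicand G x)
  set s := √(radicand G x) with hsdef
  set m := x.P1.1 - γ G ^ 2 * x.P2.1 with hm
  have hxI : (1 - γ G ^ 2) * xI G x = m + s := by
    unfold xI; field_simp; rfl
  -- the factorization at the two crossings
  have hfac : ∀ g, (1 - γ G ^ 2) * goalAdv12 G x g
      = ((1 - γ G ^ 2) * (xI G x - g)) * ((1 - γ G ^ 2) * g - (m - s)) := fun g => by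
    rw [mul_sub _ (xI G x), hxI]
    have : (1 - γ G ^ 2) * goalAdv12 G x g = s ^ 2 - ((1 - γ G ^ 2) * g - m) ^ 2 := by
      rw [hs]; simp only [radicand, goalAdv12, advantage, hm]; ring
    rw [this]; ring
  have hxIge : m - s ≤ (1 - γ G ^ 2) * xI G x := by linarith
  have hms : m - s ≤ 0 := by
    by_contra! hcon
    have h2 := hfac 0
    have h3 : 0 < (1 - γ G ^ 2) * (xI G x - 0) := by rw [sub_zero]; linarith
    have h4 : 0 ≤ (1 - γ G ^ 2) * goalAdv12 G x 0 := by positivity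
    nlinarith
  have hxI0 : 0 ≤ xI G x := by
    by_contra! hcon
    have h3 : (1 - γ G ^ 2) * xI G x < 0 := mul_neg_of_pos_of_neg hc hcon
    have h4 : 0 ≤ (1 - γ G ^ 2) * goalAdv12 G x 0 := by positivity
    have h2 := hfac 0
    rw [sub_zero, mul_zero, zero_sub] at h2
    have : (1 - γ G ^ 2) * xI G x * -(m - s) < 0 := mul_neg_of_neg_of_pos h3 (by linarith)
    linarith
  refine ⟨hr0, hxI0, ?_, ?_, fun g hg => ?_, fun g hg0 hg1 => ?_, fun g hg => ?_⟩
  · by_contra! hcon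
    have h2 := hfac G.xbar
    have h3 : 0 < (1 - γ G ^ 2) * (xI G x - G.xbar) := mul_pos hc (by linarith)
    have h4 : 0 < (1 - γ G ^ 2) * G.xbar := mul_pos hc hx
    have h5 := mul_pos h3 (by linarith : 0 < (1 - γ G ^ 2) * G.xbar - (m - s))
    have h6 : (1 - γ G ^ 2) * goalAdv12 G x G.xbar ≤ 0 :=
      mul_nonpos_of_nonneg_of_nonpos hc.le h1
    linarith
  · have := hfac (xI G x)
    rw [sub_self, mul_zero, zero_mul] at this
    exact (mul_eq_zero.1 this).resolve_left hc.ne'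
  · by_contra! hcon
    have h2 := hfac g
    rw [hg, mul_zero] at h2
    have h3 : (1 - γ G ^ 2) * (xI G x - g) < 0 := mul_neg_of_pos_of_neg hc (by linarith)
    have h4 : 0 < (1 - γ G ^ 2) * g := mul_pos hc (by linarith)
    have := mul_neg_of_neg_of_pos h3 (by linarith : 0 < (1 - γ G ^ 2) * g - (m - s))
    linarith
  · refine nonneg_of_mul_nonneg_right (?_ : 0 ≤ (1 - γ G ^ 2) * _) hc
    rw [hfac]
    have h4 : 0 ≤ (1 - γ G ^ 2) * g := by positivity
    exact mul_nonneg (mul_nonneg hc.le (by linarith)) (by linarith)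
  · refine le_of_mul_le_mul_left (?_ : (1 - γ G ^ 2) * _ ≤ _ * 0) hc
    rw [hfac, mul_zero]
    have h4 : 0 ≤ (1 - γ G ^ 2) * g := mul_nonneg hc.le (by linarith)
    exact mul_nonpos_of_nonpos_of_nonneg
      (mul_nonpos_of_nonneg_of_nonpos hc.le (by linarith)) (by linarith)

theorem thresholds_ordered {G : Game} (hG : G.Ordered) {x : State} (hx : Crossing G x) :
    τ₁ G x ≤ τ₂ G x ∧ τ₂ G x ≤ τ₃ G x ∧ τ₃ G x ≤ τ₄ G x := by
  refine ⟨?_, ?_, ?_⟩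
  · have := mul_nonneg hG.one_sub_γ₁_sq_pos.le hx.xI_nonneg
    unfold τ₁ τ₂; linarith
  · have h1 : (1 - γ G ^ 2) * xI G x = x.P1.1 - γ G ^ 2 * x.P2.1 + √(radicand G x) := by
      have := hG.one_sub_γ_sq_pos.ne'
      unfold xI; field_simp
    have h2 : γ₂ G ^ 2 = γ₁ G ^ 2 * γ G ^ 2 := by rw [← hG.γ₁_mul_γ, mul_pow]
    have h3 : 0 ≤ γ₁ G ^ 2 * √(radicand G x) := by positivity
    have : τ₃ G x - τ₂ G x = γ₁ G ^ 2 * √(radicand G x) := by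
      unfold τ₃ τ₂
      rw [h2]
      linear_combination γ₁ G ^ 2 * h1
    linarith
  · have := mul_le_mul_of_nonneg_left hx.xI_le hG.one_sub_γ₂_sq_pos.le
    unfold τ₃ τ₄; linarith

/-! ### The Barrier function and the goal line -/

/-- The value of the Barrier function compared with the advantages of the evader on the goal
line. -/
structure Decision (G : Game) (x : State) : Prop where
  aim_mem : aimPoint G x ∈ Set.Icc 0 G.xbar
  pos : 0 < barrier G x → 0 < goalAdv1 G x (aimPoint G x) ∧ 0 < goalAdv2 G x (aimPoint G x)
  nonneg : 0 ≤ barrier G x → 0 ≤ goalAdv1 G x (aimPoint G x) ∧ 0 ≤ goalAdv2 G x (aimPoint G x)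
  barrier_nonneg : ∀ g ∈ Set.Icc 0 G.xbar, 0 ≤ goalAdv1 G x g → 0 ≤ goalAdv2 G x g →
    0 ≤ barrier G x
  unique : barrier G x = 0 → ∀ g ∈ Set.Icc 0 G.xbar, 0 ≤ goalAdv1 G x g → 0 ≤ goalAdv2 G x g →
    g = aimPoint G x
  le_τ₃ : τ₂ G x ≤ τ₃ G x
  act1 : barrier G x = 0 → x.E.1 ≤ τ₃ G x → goalAdv1 G x (aimPoint G x) = 0
  act2 : barrier G x = 0 → τ₂ G x < x.E.1 → goalAdv2 G x (aimPoint G x) = 0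

/-- A point `h` at which one of the advantages is largest and not larger than the other one decides
the game. -/
theorem sign_rules_of_maximum {B κ c h L : ℝ} {a b : ℝ → ℝ} (hκ : 0 < κ) (hc : 0 < c) (hB : B = κ * a h)
    (hab : a h ≤ b h) (hmax : ∀ g ∈ Set.Icc 0 L, 0 ≤ a g → 0 ≤ b g → c * (g - h) ^ 2 ≤ a h) :
    (0 < B → 0 < a h ∧ 0 < b h) ∧ (0 ≤ B → 0 ≤ a h ∧ 0 ≤ b h) ∧
    (∀ g ∈ Set.Icc 0 L, 0 ≤ a g → 0 ≤ b g → 0 ≤ B) ∧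
    (B = 0 → ∀ g ∈ Set.Icc 0 L, 0 ≤ a g → 0 ≤ b g → g = h) ∧ (B = 0 → a h = 0) := by
  subst hB
  refine ⟨fun h1 => ?_, fun h1 => ?_, fun g hg h1 h2 => ?_, fun h0 g hg h1 h2 => ?_, fun h0 => ?_⟩
  · have := pos_of_mul_pos_right h1 hκ.le
    exact ⟨this, this.trans_le hab⟩
  · have := nonneg_of_mul_nonneg_right h1 hκ
    exact ⟨this, this.trans hab⟩
  · have := hmax g hg h1 h2
    have : 0 ≤ c * (g - h) ^ 2 := by positivity
    exact mul_nonneg hκ.le (by linarith)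
  · have h3 := hmax g hg h1 h2
    rw [(mul_eq_zero.1 h0).resolve_left hκ.ne'] at h3
    have h4 : (g - h) ^ 2 ≤ 0 := by
      by_contra! hcon
      have := mul_pos hc hcon
      linarith
    linarith [pow_eq_zero_iff two_ne_zero |>.1 (le_antisymm h4 (sq_nonneg _))]
  · exact (mul_eq_zero.1 h0).resolve_left hκ.ne'

theorem advantage_le_of {c : ℝ} {E P : ℝ × ℝ} {g h : ℝ}
    (hgh : (g - h) * (E.1 - c ^ 2 * P.1 - (1 - c ^ 2) * h) ≤ 0) :
    advantage c E P (g, 0) + (1 - c ^ 2) * (g - h) ^ 2 ≤ advantage c E P (h, 0) := by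
  linarith [advantage_sub_advantage c E P g h]

theorem mul_apolloniusAbscissa {c : ℝ} (hc : 1 - c ^ 2 ≠ 0) (E P : ℝ × ℝ) :
    (1 - c ^ 2) * apolloniusAbscissa c E P = E.1 - c ^ 2 * P.1 := by
  unfold apolloniusAbscissa; field_simp

/-- In the second range of `x_E` the centre of the `EP₁` circle is to the left of `x_I`. -/
theorem centre1_mem {G : Game} (hG : G.Ordered) {x : State} (h1 : τ₁ G x < x.E.1)
    (h2 : x.E.1 ≤ τ₂ G x) :
    0 ≤ apolloniusAbscissa (γ₁ G) x.E x.P1 ∧ apolloniusAbscissa (γ₁ G) x.E x.P1 ≤ xI G x := by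
  have hc := hG.one_sub_γ₁_sq_pos
  have hm := mul_apolloniusAbscissa hc.ne' x.E x.P1
  unfold τ₁ at h1
  unfold τ₂ at h2
  constructor
  · exact nonneg_of_mul_nonneg_right (by rw [hm]; linarith) hc
  · exact le_of_mul_le_mul_left (by rw [hm]; linarith) hc

/-- In the fourth range of `x_E` the centre of the `EP₂` circle is between `x_I` and the right
corner. -/
theorem centre2_mem {G : Game} (hG : G.Ordered) {x : State} (h3 : τ₃ G x < x.E.1)
    (h4 : x.E.1 ≤ τ₄ G x) :
    xI G x ≤ apolloniusAbscissa (γ₂ G) x.E x.P2 ∧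
      apolloniusAbscissa (γ₂ G) x.E x.P2 ≤ G.xbar := by
  have hc := hG.one_sub_γ₂_sq_pos
  have hm := mul_apolloniusAbscissa hc.ne' x.E x.P2
  unfold τ₃ at h3
  unfold τ₄ at h4
  constructor
  · exact le_of_mul_le_mul_left (by rw [hm]; linarith) hc
  · exact le_of_mul_le_mul_left (by rw [hm]; linarith) hc

theorem B₂_eq {G : Game} (hG : G.Ordered) (x : State) :
    B₂ G x = (1 - γ₁ G ^ 2) * goalAdv1 G x (apolloniusAbscissa (γ₁ G) x.E x.P1) :=
  (advantage_eq_at_centre hG.one_sub_γ₁_sq_pos.ne' x.E x.P1).symm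

theorem B₄_eq {G : Game} (hG : G.Ordered) (x : State) :
    B₄ G x = (1 - γ₂ G ^ 2) * goalAdv2 G x (apolloniusAbscissa (γ₂ G) x.E x.P2) :=
  (advantage_eq_at_centre hG.one_sub_γ₂_sq_pos.ne' x.E x.P2).symm

theorem B₁_eq (G : Game) (x : State) : B₁ G x = goalAdv1 G x 0 := by
  simp only [B₁, goalAdv1, advantage]; ring

theorem B₃_eq (G : Game) (x : State) : B₃ G x = goalAdv1 G x (xI G x) := by
  simp only [B₃, goalAdv1, advantage]; ring

theorem B₅_eq (G : Game) (x : State) : B₅ G x = goalAdv2 G x G.xbar := by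
  simp only [B₅, goalAdv2, advantage]; ring

theorem decision {G : Game} (hG : G.Ordered) {x : State} (hx : Crossing G x) :
    Decision G x := by
  have hc1 := hG.one_sub_γ₁_sq_pos
  have hc2 := hG.one_sub_γ₂_sq_pos
  obtain ⟨ho1, ho2, ho3⟩ := thresholds_ordered hG hx
  have hγ : 0 ≤ γ₁ G ^ 2 := sq_nonneg _
  have hL : ∀ g, 0 ≤ g → g ≤ xI G x → goalAdv1 G x g ≤ goalAdv2 G x g := fun g h0 h1 => by
    rw [goalAdv2_eq hG]; linarith [mul_nonneg hγ (hx.left g h0 h1)]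
  have hR : ∀ g, xI G x ≤ g → goalAdv2 G x g ≤ goalAdv1 G x g := fun g h0 => by
    rw [goalAdv2_eq hG]; linarith [mul_nonpos_of_nonneg_of_nonpos hγ (hx.right g h0)]
  have hm1 := mul_apolloniusAbscissa hc1.ne' x.E x.P1
  have hm2 := mul_apolloniusAbscissa hc2.ne' x.E x.P2
  by_cases h1 : x.E.1 ≤ τ₁ G x
  · have hB : barrier G x = B₁ G x := by simp [barrier, pieces, h1]
    have hA : aimPoint G x = 0 := by simp [aimPoint, pieces, h1]
    obtain ⟨d1, d2, d3, d4, d5⟩ := sign_rules_of_maximum (L := G.xbar) (h := 0) one_pos hc1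
      (show barrier G x = 1 * goalAdv1 G x 0 by rw [hB, B₁_eq, one_mul])
      (hL 0 le_rfl hx.xI_nonneg) (fun g hg g1 _ => by
        refine (le_add_of_nonneg_left g1).trans (advantage_le_of ?_)
        unfold τ₁ at h1
        exact mul_nonpos_of_nonneg_of_nonpos (by linarith [hg.1]) (by linarith))
    constructor <;> try rw [hA]
    exacts [⟨le_rfl, hG.xbar_pos.le⟩, d1, d2, d3, d4, ho2, fun h _ => d5 h, fun _ h => by linarith]
  by_cases h2 : x.E.1 ≤ τ₂ G x
  · have hB : barrier G x = B₂ G x := by simp [barrier, pieces, h1, h2]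
    have hA : aimPoint G x = apolloniusAbscissa (γ₁ G) x.E x.P1 := by
      simp [aimPoint, pieces, h1, h2]
    obtain ⟨e1, e2⟩ := centre1_mem hG (not_le.1 h1) h2
    obtain ⟨d1, d2, d3, d4, d5⟩ := sign_rules_of_maximum (L := G.xbar) hc1 hc1
      (hB.trans (B₂_eq hG x)) (hL _ e1 e2) (fun g hg g1 _ => by
        refine (le_add_of_nonneg_left g1).trans (advantage_le_of ?_)
        rw [hm1, sub_self, mul_zero])
    constructor <;> try rw [hA]
    exacts [⟨e1, e2.trans hx.xI_le⟩, d1, d2, d3, d4, ho2, fun h _ => d5 h, fun _ h => by linarith]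
  by_cases h3 : x.E.1 ≤ τ₃ G x
  · have hB : barrier G x = B₃ G x := by simp [barrier, pieces, h1, h2, h3]
    have hA : aimPoint G x = xI G x := by simp [aimPoint, pieces, h1, h2, h3]
    have heq : goalAdv2 G x (xI G x) = goalAdv1 G x (xI G x) :=
      le_antisymm (hR _ le_rfl) (hL _ hx.xI_nonneg le_rfl)
    have hlt := hG.γ₁_mul_γ
    have hcc : 1 - γ₁ G ^ 2 ≤ 1 - γ₂ G ^ 2 := by
      have := hG.γ₁_pos
      have : γ₂ G ≤ γ₁ G := by rw [← hlt]; nlinarith [hG.γ_lt_one]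
      nlinarith [hG.γ₂_pos]
    obtain ⟨d1, d2, d3, d4, d5⟩ := sign_rules_of_maximum (L := G.xbar) (b := goalAdv2 G x) (h := xI G x)
      one_pos hc1
      (show barrier G x = 1 * goalAdv1 G x (xI G x) by rw [hB, B₃_eq, one_mul]) heq.ge
      (fun g hg g1 g2 => by
        rcases le_total g (xI G x) with h | h
        · refine (le_add_of_nonneg_left g1).trans (advantage_le_of ?_)
          unfold τ₂ at h2
          exact mul_nonpos_of_nonpos_of_nonneg (by linarith) (by linarith)
        · rw [← heq]
          refine (mul_le_mul_of_nonneg_right hcc (sq_nonneg _)).trans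
            ((le_add_of_nonneg_left g2).trans (advantage_le_of ?_))
          unfold τ₃ at h3
          exact mul_nonpos_of_nonneg_of_nonpos (by linarith) (by linarith))
    constructor <;> try rw [hA]
    exacts [⟨hx.xI_nonneg, hx.xI_le⟩, d1, d2, d3, d4, ho2, fun h _ => d5 h, fun h _ => heq.trans (d5 h)]
  have key : ∀ (κ h : ℝ), 0 < κ → aimPoint G x = h → xI G x ≤ h → h ≤ G.xbar →
      barrier G x = κ * goalAdv2 G x h →
      (∀ g ∈ Set.Icc 0 G.xbar, (g - h) * (x.E.1 - γ₂ G ^ 2 * x.P2.1 - (1 - γ₂ G ^ 2) * h) ≤ 0) →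
      Decision G x := fun κ h hκ hA hh1 hh2 hB hgh => by
    obtain ⟨d1, d2, d3, d4, d5⟩ := sign_rules_of_maximum hκ hc2 hB (hR h hh1)
      (fun g hg g2 _ => (le_add_of_nonneg_left g2).trans (advantage_le_of (hgh g hg)))
    constructor <;> try rw [hA]
    exacts [⟨hx.xI_nonneg.trans hh1, hh2⟩, fun h => (d1 h).symm, fun h => (d2 h).symm,
      fun g hg g1 g2 => d3 g hg g2 g1, fun h g hg g1 g2 => d4 h g hg g2 g1, ho2,
      fun _ h => absurd h h3, fun h _ => d5 h]
  by_cases h4 : x.E.1 ≤ τ₄ G x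
  · obtain ⟨e1, e2⟩ := centre2_mem hG (not_le.1 h3) h4
    refine key _ _ hc2 (by simp [aimPoint, pieces, h1, h2, h3, h4]) e1 e2 ?_ fun g _ => ?_
    · rw [← B₄_eq hG]; simp [barrier, pieces, h1, h2, h3, h4]
    · rw [hm2, sub_self, mul_zero]
  · refine key 1 _ one_pos (by simp [aimPoint, pieces, h1, h2, h3, h4]) hx.xI_le le_rfl ?_
      fun g hg => ?_
    · rw [one_mul, ← B₅_eq]; simp [barrier, pieces, h1, h2, h3, h4]
    · unfold τ₄ at h4
      exact mul_nonpos_of_nonpos_of_nonneg (by linarith [hg.2]) (by linarith)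

/-! ### The strategies of the two teams -/

/-- A pursuer over which the evader has a non-negative advantage at `(g, 0)` does not meet the evader
during its straight run to `(g, 0)`; if the advantage is positive, then not on arrival either. -/
theorem not_meets_run {v w T t g : ℝ} {p P : ℝ × ℝ} {φ ψ : ℝ → ℝ} (hv : 0 < v) (hvw : v < w)
    (hψ : Measurable ψ) (h0 : 0 ≤ t) (h1 : t ≤ T)
    (hT : (p.1 - g) ^ 2 + p.2 ^ 2 = (v * T) ^ 2)
    (hrun : ((position v p φ t).1 - g) ^ 2 + (position v p φ t).2 ^ 2 = (v * (T - t)) ^ 2)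
    (hadv : 0 ≤ advantage (v / w) p P (g, 0))
    (hstrict : t < T ∨ 0 < advantage (v / w) p P (g, 0)) :
    position w P ψ t ≠ position v p φ t := by
  intro hmeet
  have hw : 0 < w := hv.trans hvw
  have hD := sq_dist_le_of_meets_run hv hvw hψ h0 h1 hrun hmeet
  have hval : w ^ 2 * advantage (v / w) p P (g, 0)
      = v ^ 2 * ((P.1 - g) ^ 2 + P.2 ^ 2 - (w * T) ^ 2) := by
    simp only [advantage, sub_zero, hT]
    field_simp
  have hle : w * t + v * (T - t) ≤ w * T := by nlinarith
  have hnn : 0 ≤ w * t + v * (T - t) :=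
    add_nonneg (mul_nonneg hw.le h0) (mul_nonneg hv.le (sub_nonneg.2 h1))
  rcases hstrict with h | h
  · have h2 : w * t + v * (T - t) < w * T := by nlinarith
    have h3 : (w * t + v * (T - t)) ^ 2 < (w * T) ^ 2 := by gcongr
    have h4 : v ^ 2 * ((P.1 - g) ^ 2 + P.2 ^ 2 - (w * T) ^ 2) < 0 :=
      mul_neg_of_pos_of_neg (by positivity) (by linarith)
    have h5 : 0 ≤ w ^ 2 * advantage (v / w) p P (g, 0) := by positivity
    linarith
  · have h3 : (w * t + v * (T - t)) ^ 2 ≤ (w * T) ^ 2 := by gcongr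
    have h4 : v ^ 2 * ((P.1 - g) ^ 2 + P.2 ^ 2 - (w * T) ^ 2) ≤ 0 :=
      mul_nonpos_of_nonneg_of_nonpos (by positivity) (by linarith)
    have h5 : 0 < w ^ 2 * advantage (v / w) p P (g, 0) := by positivity
    linarith

/-- The evader can run straight to a point of the goal line at which it has non-negative
advantages. -/
theorem exists_run {G : Game} (hG : G.Ordered) {x : State} (hE : x.E ∈ field G) {g : ℝ}
    (hg : g ∈ Set.Icc 0 G.xbar) (h1 : 0 ≤ goalAdv1 G x g) (h2 : 0 ≤ goalAdv2 G x g) :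
    ∃ φ T, Admissible G G.vE x.E φ ∧ 0 ≤ T ∧ position G.vE x.E φ T = (g, 0) ∧
      ∀ ψ₁ ψ₂, Measurable ψ₁ → Measurable ψ₂ → ∀ t, 0 ≤ t → t ≤ T →
        (t < T ∨ 0 < goalAdv1 G x g ∧ 0 < goalAdv2 G x g) → ¬ Captured G x φ ψ₁ ψ₂ t := by
  obtain ⟨φ, T, hφ, hT0, hT, hrun⟩ := exists_straight_run hG.vE_pos hE hg
  refine ⟨φ, T, hφ, hT0, ?_, fun ψ₁ ψ₂ hψ₁ hψ₂ t ht0 htT hs => ?_⟩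
  · have := hrun T hT0 le_rfl
    rw [sub_self, mul_zero, zero_pow two_ne_zero] at this
    have e1 := pow_eq_zero_iff two_ne_zero |>.1
      (((add_eq_zero_iff_of_nonneg (sq_nonneg _) (sq_nonneg _)).1 this).1)
    have e2 := pow_eq_zero_iff two_ne_zero |>.1
      (((add_eq_zero_iff_of_nonneg (sq_nonneg _) (sq_nonneg _)).1 this).2)
    exact Prod.ext (sub_eq_zero.1 e1) e2
  · rintro (h | h)
    · exact not_meets_run hG.vE_pos hG.vE_lt hψ₁ ht0 htT hT (hrun t ht0 htT) h1
        (hs.imp_right And.left) h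
    · exact not_meets_run hG.vE_pos hG.vE_lt_v2 hψ₂ ht0 htT hT (hrun t ht0 htT) h2
        (hs.imp_right And.right) h

theorem evaderStrategy_const {G : Game} {x : State} {φ : ℝ → ℝ}
    (hφ : Admissible G G.vE x.E φ) : EvaderStrategy G x fun _ _ => φ where
  admissible _ _ _ _ := hφ
  delay := ⟨1, one_pos, fun _ _ _ _ _ _ _ _ _ _ _ => Eventually.of_forall fun _ => rfl⟩

/-- Both pursuers use parallel pursuit, folded into the field. -/
theorem exists_pursuerStrategy {G : Game} (hG : G.Ordered) {x : State}
    (hP1 : x.P1 ∈ field G) (hP2 : x.P2 ∈ field G) :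
    ∃ β M, PursuerStrategy G x β ∧ ∀ φ, Admissible G G.vE x.E φ →
      ∃ T, 0 ≤ T ∧ T ≤ M ∧ Captured G x φ (β φ).1 (β φ).2 T ∧
        ∀ t g, 0 ≤ t → t ≤ T → position G.vE x.E φ t = (g, 0) →
          0 ≤ goalAdv1 G x g ∧ 0 ≤ goalAdv2 G x g ∧
          (t < T → 0 < goalAdv1 G x g ∧ 0 < goalAdv2 G x g) ∧
          (goalAdv1 G x g = 0 → CapturedBy1 G x φ (β φ).1 t) ∧
          (goalAdv2 G x g = 0 → CapturedBy2 G x φ (β φ).2 t) := by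
  obtain ⟨β₁, M₁, ha1, hn1, hc1⟩ := exists_pursuit hG.xbar_pos hG.vE_pos hG.vE_lt x.E hP1
  obtain ⟨β₂, M₂, ha2, hn2, hc2⟩ := exists_pursuit hG.xbar_pos hG.vE_pos hG.vE_lt_v2 x.E hP2
  refine ⟨fun φ => (β₁ φ, β₂ φ), min M₁ M₂, ⟨fun φ hφ => ⟨ha1 φ hφ, ha2 φ hφ⟩,
    fun φ φ' _ _ t h => ⟨hn1 φ φ' t h, hn2 φ φ' t h⟩⟩, fun φ hφ => ?_⟩
  obtain ⟨T₁, hT1, hM1, hcap1, hnn1, hpos1⟩ := hc1 φ hφ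
  obtain ⟨T₂, hT2, hM2, hcap2, hnn2, hpos2⟩ := hc2 φ hφ
  refine ⟨min T₁ T₂, le_min hT1 hT2, min_le_min hM1 hM2, ?_, fun t g h0 ht hpos => ?_⟩
  · rcases min_choice T₁ T₂ with h | h <;> rw [h]
    exacts [Or.inl hcap1, Or.inr hcap2]
  have ht1 := ht.trans (min_le_left _ _)
  have ht2 := ht.trans (min_le_right _ _)
  have p1 := hnn1 t h0 ht1
  have p2 := hnn2 t h0 ht2
  have q1 := hpos1 t h0
  have q2 := hpos2 t h0
  rw [hpos] at p1 p2 q1 q2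
  refine ⟨p1, p2, fun h => ⟨q1 (h.trans_le (min_le_left _ _)), q2 (h.trans_le (min_le_right _ _))⟩,
    fun hz => ?_, fun hz => ?_⟩
  · obtain rfl : t = T₁ := ht1.eq_of_not_lt fun h => (q1 h).ne' hz
    exact hcap1
  · obtain rfl : t = T₂ := ht2.eq_of_not_lt fun h => (q2 h).ne' hz
    exact hcap2

/-- A strategy of the evader with delay and a strategy of the pursuers determine a play up to any
given time. -/
theorem exists_play {G : Game} {x : State} {α : (ℝ → ℝ) → (ℝ → ℝ) → (ℝ → ℝ)}
    {β : (ℝ → ℝ) → (ℝ → ℝ) × (ℝ → ℝ)} (hα : EvaderStrategy G x α) (hβ : PursuerStrategy G x β)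
    {φ₀ : ℝ → ℝ} (hφ₀ : Admissible G G.vE x.E φ₀) (M : ℝ) :
    ∃ φ, Admissible G G.vE x.E φ ∧ AgreeUpTo M φ (α (β φ).1 (β φ).2) := by
  obtain ⟨τ, hτ, hdelay⟩ := hα.delay
  set next : (ℝ → ℝ) → (ℝ → ℝ) := fun φ => α (β φ).1 (β φ).2 with hnext
  have hadm : ∀ φ, Admissible G G.vE x.E φ → Admissible G G.vE x.E (next φ) := fun φ h =>
    hα.admissible _ _ (hβ.admissible φ h).1 (hβ.admissible φ h).2
  have hiter : ∀ k : ℕ, ∃ φ, Admissible G G.vE x.E φ ∧ AgreeUpTo (k * τ) φ (next φ) := by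
    intro k
    induction k with
    | zero =>
      refine ⟨φ₀, hφ₀, ?_⟩
      rw [AgreeUpTo, Nat.cast_zero, zero_mul, Set.Icc_self, Measure.restrict_singleton]
      simp
    | succ k ih =>
      obtain ⟨φ, hφ, hag⟩ := ih
      refine ⟨next φ, hadm φ hφ, ?_⟩
      have h1 := hβ.nonanticipative φ (next φ) hφ (hadm φ hφ) _ hag
      have h2 := hβ.admissible φ hφ
      have h3 := hβ.admissible _ (hadm φ hφ)
      have := hdelay _ _ _ _ h2.1 h2.2 h3.1 h3.2 _ h1.1 h1.2
      rwa [Nat.cast_succ, add_mul, one_mul]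
  obtain ⟨k, hk⟩ := exists_nat_ge (M / τ)
  obtain ⟨φ, hφ, hag⟩ := hiter k
  exact ⟨φ, hφ, hag.mono ((div_le_iff₀ hτ).1 hk)⟩

theorem mem_goalLine_iff {G : Game} {p : ℝ × ℝ} :
    p ∈ goalLine G ↔ ∃ g ∈ Set.Icc 0 G.xbar, p = (g, 0) := by
  constructor
  · rintro ⟨⟨h1, h2, -⟩, h0⟩
    exact ⟨p.1, ⟨h1, h2⟩, Prod.ext rfl h0⟩
  · rintro ⟨g, hg, rfl⟩
    exact ⟨⟨hg.1, hg.2, le_rfl⟩, rfl⟩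

section
variable {G : Game} {x : State}

theorem evaderWins_of_pos (hG : G.Ordered) (hE : x.E ∈ field G) (hd : Decision G x)
    (hB : 0 < barrier G x) : EvaderWins G x := by
  obtain ⟨h1, h2⟩ := hd.pos hB
  obtain ⟨φ, T, hφ, hT0, hT, hrun⟩ := exists_run hG hE hd.aim_mem h1.le h2.le
  exact ⟨fun _ _ => φ, evaderStrategy_const hφ, fun ψ₁ ψ₂ hψ₁ hψ₂ => ⟨T, hT0,
    mem_goalLine_iff.2 ⟨_, hd.aim_mem, hT⟩, fun t h0 ht =>
      hrun ψ₁ ψ₂ hψ₁.measurable hψ₂.measurable t h0 ht (Or.inr ⟨h1, h2⟩)⟩⟩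

theorem evaderSecures_of_nonneg (hG : G.Ordered) (hE : x.E ∈ field G) (hd : Decision G x)
    (hB : 0 ≤ barrier G x) : EvaderSecures G x (aimPoint G x) := by
  obtain ⟨h1, h2⟩ := hd.nonneg hB
  obtain ⟨φ, T, hφ, hT0, hT, hrun⟩ := exists_run hG hE hd.aim_mem h1 h2
  exact ⟨fun _ _ => φ, evaderStrategy_const hφ, fun ψ₁ ψ₂ hψ₁ hψ₂ => ⟨T, hT0, hT, fun t h0 ht =>
      hrun ψ₁ ψ₂ hψ₁.measurable hψ₂.measurable t h0 ht.le (Or.inl ht)⟩⟩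

theorem not_pursuersWin_of_nonneg (hG : G.Ordered) (hE : x.E ∈ field G) (hd : Decision G x)
    (hB : 0 ≤ barrier G x) : ¬ PursuersWin G x := by
  rintro ⟨β, hβ, hwin⟩
  obtain ⟨h1, h2⟩ := hd.nonneg hB
  obtain ⟨φ, T, hφ, hT0, hT, hrun⟩ := exists_run hG hE hd.aim_mem h1 h2
  obtain ⟨T', hT'0, hcap, hout⟩ := hwin φ hφ
  have hadm := hβ.admissible φ hφ
  rcases lt_or_ge T' T with h | h
  · exact hrun _ _ hadm.1.measurable hadm.2.measurable T' hT'0 h.le (Or.inl h) hcap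
  · exact hout T hT0 h (mem_goalLine_iff.2 ⟨_, hd.aim_mem, hT⟩)

theorem pursuersWin_of_neg (hG : G.Ordered) (hP1 : x.P1 ∈ field G) (hP2 : x.P2 ∈ field G)
    (hd : Decision G x) (hB : barrier G x < 0) : PursuersWin G x := by
  obtain ⟨β, M, hβ, hcap⟩ := exists_pursuerStrategy hG hP1 hP2
  refine ⟨β, hβ, fun φ hφ => ?_⟩
  obtain ⟨T, hT0, -, hT, hgoal⟩ := hcap φ hφ
  refine ⟨T, hT0, hT, fun t h0 ht hmem => ?_⟩
  obtain ⟨g, hg, hpos⟩ := mem_goalLine_iff.1 hmem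
  obtain ⟨h1, h2, -⟩ := hgoal t g h0 ht hpos
  exact hB.not_ge (hd.barrier_nonneg g hg h1 h2)

/-- If the Barrier function is not positive, then the pursuers have a strategy that captures the
evader within a bounded time, not later than it is on the goal line. -/
theorem exists_pursuerStrategy_of_nonpos (hG : G.Ordered) (hP1 : x.P1 ∈ field G)
    (hP2 : x.P2 ∈ field G) (hd : Decision G x) (hB : barrier G x ≤ 0) :
    ∃ β M, PursuerStrategy G x β ∧ ∀ φ, Admissible G G.vE x.E φ →
      ∃ T, 0 ≤ T ∧ T ≤ M ∧ Captured G x φ (β φ).1 (β φ).2 T ∧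
      (∀ t, 0 ≤ t → t < T → position G.vE x.E φ t ∉ goalLine G) ∧
      (position G.vE x.E φ T ∈ goalLine G →
        position G.vE x.E φ T = (aimPoint G x, 0) ∧
        (x.E.1 ≤ τ₃ G x → CapturedBy1 G x φ (β φ).1 T) ∧
        (τ₂ G x < x.E.1 → CapturedBy2 G x φ (β φ).2 T)) := by
  obtain ⟨β, M, hβ, hcap⟩ := exists_pursuerStrategy hG hP1 hP2
  refine ⟨β, M, hβ, fun φ hφ => ?_⟩
  obtain ⟨T, hT0, hTM, hT, hgoal⟩ := hcap φ hφ
  have key : ∀ t, 0 ≤ t → t ≤ T → position G.vE x.E φ t ∈ goalLine G →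
      barrier G x = 0 ∧ position G.vE x.E φ t = (aimPoint G x, 0) := fun t h0 ht hmem => by
    obtain ⟨g, hg, hpos⟩ := mem_goalLine_iff.1 hmem
    obtain ⟨h1, h2, -⟩ := hgoal t g h0 ht hpos
    have hB0 := le_antisymm hB (hd.barrier_nonneg g hg h1 h2)
    exact ⟨hB0, by rw [hpos, hd.unique hB0 g hg h1 h2]⟩
  refine ⟨T, hT0, hTM, hT, fun t h0 ht hmem => ?_, fun hmem => ?_⟩
  · obtain ⟨hB0, hpos⟩ := key t h0 ht.le hmem
    obtain ⟨-, -, h3, -⟩ := hgoal t _ h0 ht.le hpos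
    rcases le_or_gt x.E.1 (τ₃ G x) with h | h
    · exact (h3 ht).1.ne' (hd.act1 hB0 h)
    · exact (h3 ht).2.ne' (hd.act2 hB0 (hd.le_τ₃.trans_lt h))
  · obtain ⟨hB0, hpos⟩ := key T hT0 le_rfl hmem
    obtain ⟨-, -, -, h4, h5⟩ := hgoal T _ hT0 le_rfl hpos
    exact ⟨hpos, fun h => h4 (hd.act1 hB0 h), fun h => h5 (hd.act2 hB0 h)⟩

theorem not_evaderWins_of_nonpos (hG : G.Ordered) (hE : x.E ∈ field G) (hP1 : x.P1 ∈ field G)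
    (hP2 : x.P2 ∈ field G) (hd : Decision G x) (hB : barrier G x ≤ 0) : ¬ EvaderWins G x := by
  rintro ⟨α, hα, hwin⟩
  obtain ⟨β, M, hβ, hcap⟩ := exists_pursuerStrategy_of_nonpos hG hP1 hP2 hd hB
  obtain ⟨φ₀, -, hφ₀, -⟩ := exists_straight_run hG.vE_pos hE hd.aim_mem
  obtain ⟨φ, hφ, hag⟩ := exists_play hα hβ hφ₀ M
  obtain ⟨T, hT0, hTM, hT, hout, -⟩ := hcap φ hφ
  have hadm := hβ.admissible φ hφ
  obtain ⟨T', hT'0, hgoal, hfree⟩ := hwin _ _ hadm.1 hadm.2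
  have hsame : ∀ t, 0 ≤ t → t ≤ T → position G.vE x.E φ t
      = position G.vE x.E (α (β φ).1 (β φ).2) t := fun t h0 ht =>
    (hag.mono (ht.trans hTM)).position_eq h0 _ _
  rcases lt_or_ge T' T with h | h
  · refine hout T' hT'0 h ?_
    rwa [hsame T' hT'0 h.le]
  · refine hfree T hT0 h ?_
    unfold Captured CapturedBy1 CapturedBy2 at hT ⊢
    rwa [← hsame T hT0 le_rfl]

end

end Football

end

theorem theorem2 (G : Football.Game) (hxbar : 0 < G.xbar) (hvE : 0 < G.vE)
    (h1 : G.vE < G.v1) (h2 : G.v1 < G.v2)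
    (x : Football.State) (hE : x.E ∈ Football.field G)
    (hP1 : x.P1 ∈ Football.field G) (hP2 : x.P2 ∈ Football.field G)
    -- `P₁` is the first pursuer at the left corner, `P₂` is the first at the right corner
    (hleft : Football.travelTime G.v1 x.P1 (0, 0) ≤ Football.travelTime G.v2 x.P2 (0, 0))
    (hright : Football.travelTime G.v2 x.P2 (G.xbar, 0) ≤
      Football.travelTime G.v1 x.P1 (G.xbar, 0)) :
    -- `x_I` is the right crossing of the `P₁P₂` Apollonius circle with the `x`-axis, on the goal
    -- line
    (0 ≤ Football.radicand G x ∧ 0 ≤ Football.xI G x ∧ Football.xI G x ≤ G.xbar ∧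
      IsGreatest {g : ℝ | (g, (0 : ℝ)) ∈
        Football.apolloniusCircle (Football.γ G) x.P1 x.P2} (Football.xI G x)) ∧
    -- the five ranges of `x_E` are in order
    (Football.τ₁ G x ≤ Football.τ₂ G x ∧ Football.τ₂ G x ≤ Football.τ₃ G x ∧
      Football.τ₃ G x ≤ Football.τ₄ G x) ∧
    -- the sign of the Barrier function decides the game
    (Football.EvaderWins G x ↔ 0 < Football.barrier G x) ∧
    (Football.PursuersWin G x ↔ Football.barrier G x < 0) ∧
    ((¬ Football.EvaderWins G x ∧ ¬ Football.PursuersWin G x) ↔ Football.barrier G x = 0) ∧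
    -- play on the Barrier surface: the evader is captured on the goal line, by `P₁` in the first
    -- three pieces, by `P₂` in the last three
    (Football.barrier G x = 0 →
      Football.aimPoint G x ∈ Set.Icc 0 G.xbar ∧
      Football.EvaderSecures G x (Football.aimPoint G x) ∧
      Football.PursuersSecure G x (Football.aimPoint G x)
        (x.E.1 ≤ Football.τ₃ G x) (Football.τ₂ G x < x.E.1)) ∧
    -- the pieces of the Barrier surface in terms of Apollonius circles
    (x.E.1 ≤ Football.τ₁ G x → (Football.barrier G x = 0 ↔
      ((0 : ℝ), (0 : ℝ)) ∈ Football.apolloniusCircle (Football.γ₁ G) x.E x.P1)) ∧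
    (Football.τ₁ G x < x.E.1 → x.E.1 ≤ Football.τ₂ G x → (Football.barrier G x = 0 ↔
      Football.TangentToGoalLine G (Football.apolloniusCircle (Football.γ₁ G) x.E x.P1))) ∧
    (Football.τ₂ G x < x.E.1 → x.E.1 ≤ Football.τ₃ G x → (Football.barrier G x = 0 ↔
      (Football.xI G x, (0 : ℝ)) ∈ Football.apolloniusCircle (Football.γ₁ G) x.E x.P1 ∩
        Football.apolloniusCircle (Football.γ₂ G) x.E x.P2)) ∧
    (Football.τ₃ G x < x.E.1 → x.E.1 ≤ Football.τ₄ G x → (Football.barrier G x = 0 ↔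
      Football.TangentToGoalLine G (Football.apolloniusCircle (Football.γ₂ G) x.E x.P2))) ∧
    (Football.τ₄ G x < x.E.1 → (Football.barrier G x = 0 ↔
      (G.xbar, (0 : ℝ)) ∈ Football.apolloniusCircle (Football.γ₂ G) x.E x.P2)) := by
  have hG : G.Ordered := ⟨hxbar, hvE, h1, h2⟩
  have hx := Football.crossing hG hleft hright
  have hd := Football.decision hG hx
  have hγ12 : ∀ g : ℝ, (g, (0 : ℝ)) ∈ Football.apolloniusCircle (Football.γ G) x.P1 x.P2 ↔
      Football.goalAdv12 G x g = 0 := fun g =>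
    Football.mem_apolloniusCircle_iff hG.γ_pos hG.γ_lt_one _ _ _
  have hC1 : ∀ g : ℝ, (g, (0 : ℝ)) ∈ Football.apolloniusCircle (Football.γ₁ G) x.E x.P1 ↔
      Football.goalAdv1 G x g = 0 := fun g =>
    Football.mem_apolloniusCircle_iff hG.γ₁_pos hG.γ₁_lt_one _ _ _
  have hC2 : ∀ g : ℝ, (g, (0 : ℝ)) ∈ Football.apolloniusCircle (Football.γ₂ G) x.E x.P2 ↔
      Football.goalAdv2 G x g = 0 := fun g =>
    Football.mem_apolloniusCircle_iff hG.γ₂_pos hG.γ₂_lt_one _ _ _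
  have hord := Football.thresholds_ordered hG hx
  have hwin : Football.EvaderWins G x ↔ 0 < Football.barrier G x :=
    ⟨fun h => not_le.1 fun hB => Football.not_evaderWins_of_nonpos hG hE hP1 hP2 hd hB h,
      Football.evaderWins_of_pos hG hE hd⟩
  have hlose : Football.PursuersWin G x ↔ Football.barrier G x < 0 :=
    ⟨fun h => not_le.1 fun hB => Football.not_pursuersWin_of_nonneg hG hE hd hB h,
      Football.pursuersWin_of_neg hG hP1 hP2 hd⟩
  refine ⟨⟨hx.radicand_nonneg, hx.xI_nonneg, hx.xI_le, (hγ12 _).2 hx.eq_zero,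
    fun g hg => hx.le_xI g ((hγ12 g).1 hg)⟩, hord, hwin, hlose, ?_, fun hB => ⟨hd.aim_mem, ?_, ?_⟩,
    fun a1 => ?_, fun a1 a2 => ?_, fun a2 a3 => ?_, fun a3 a4 => ?_, fun a4 => ?_⟩
  · rw [hwin, hlose, not_lt, not_lt]
    exact ⟨fun h => le_antisymm h.1 h.2, fun h => ⟨h.le, h.ge⟩⟩
  · exact Football.evaderSecures_of_nonneg hG hE hd hB.ge
  · obtain ⟨β, M, hβ, hcap⟩ :=
      Football.exists_pursuerStrategy_of_nonpos hG hP1 hP2 hd hB.le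
    refine ⟨β, hβ, fun φ hφ => ?_⟩
    obtain ⟨T, hT0, -, hT⟩ := hcap φ hφ
    exact ⟨T, hT0, hT⟩
  · rw [hC1, ← Football.B₁_eq, Football.barrier, Football.pieces, if_pos a1]
  · obtain ⟨e1, e2⟩ := Football.centre1_mem hG a1 a2
    rw [Football.tangentToGoalLine_iff hG.γ₁_pos hG.γ₁_lt_one ⟨e1, e2.trans hx.xI_le⟩,
      Football.barrier, Football.pieces, if_neg a1.not_ge, if_pos a2, Football.B₂_eq hG,
      mul_eq_zero, or_iff_right hG.one_sub_γ₁_sq_pos.ne', Football.goalAdv1]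
  · rw [Set.mem_inter_iff, hC1, hC2, Football.goalAdv2_eq hG, hx.eq_zero, mul_zero, add_zero,
      and_self, ← Football.B₃_eq, Football.barrier, Football.pieces,
      if_neg (hord.1.trans_lt a2).not_ge, if_neg a2.not_ge, if_pos a3]
  · obtain ⟨e1, e2⟩ := Football.centre2_mem hG a3 a4
    rw [Football.tangentToGoalLine_iff hG.γ₂_pos hG.γ₂_lt_one ⟨hx.xI_nonneg.trans e1, e2⟩,
      Football.barrier, Football.pieces, if_neg ((hord.1.trans hord.2.1).trans_lt a3).not_ge,
      if_neg (hord.2.1.trans_lt a3).not_ge, if_neg a3.not_ge, if_pos a4, Football.B₄_eq hG,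
      mul_eq_zero, or_iff_right hG.one_sub_γ₂_sq_pos.ne', Football.goalAdv2]
  · have a3 := hord.2.2.trans_lt a4
    rw [hC2, ← Football.B₅_eq, Football.barrier, Football.pieces,
      if_neg ((hord.1.trans hord.2.1).trans_lt a3).not_ge,
      if_neg (hord.2.1.trans_lt a3).not_ge, if_neg a3.not_ge, if_neg a4.not_ge]
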